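/- A \emph{ZX-ground diagram} $D:n\to m$ is a finite network, considered up to topological deformation, of green (Z) and red (X) spiders of arbitrary degree with phases $\alpha\in\mathbb R/2\pi\mathbb Z$, Hadamard boxes (degree 2), ground generators (degree 1), $n$ inputs and $m$ outputs, joined by wires. Its \emph{standard interpretation} $[\![D]\!]$ is the linear map from $2^n\times 2^n$ to $2^m\times 2^m$ complex matrices obtained by composing the generators: a pure generator with matrix $A$ acts as $\rho\mapsto A\rho A^\dagger$, where $A=|0\cdots0\rangle\langle0\cdots0|+e^{i\alpha}|1\cdots1\rangle\langle1\cdots1|$ for a Z-spider (the scalar $1+e^{i\alpha}$ if it has degree $0$), the same with $|\pm\rangle$ in place of $|0\rangle,|1\rangle$ for an X-spider, and $A=\frac1{\sqrt2}\begin{pmatrix}1&1\\1&-1\end{pmatrix}$ for a Hadamard box; the ground is the trace. Two diagrams $D,D':n\to m$ are \emph{equivalent} if $[\![D]\!]=c\,[\![D']\!]$ for some real $c>0$. A \emph{Hadamard edge} is a Hadamard box whose two wires end at Z-spiders, and a \emph{ground-spider} is a Z-spider attached to a ground by a plain wire. A diagram is \emph{strictly} (respectively \emph{weakly}) \emph{graph-like}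 if: all spiders are Z-spiders; Z-spiders are connected only via Hadamard edges, every Hadamard box forms such an edge, and there are no closed circles; there are no parallel Hadamard edges and no self-loops; no two ground-spiders are connected; every input, output and ground is attached by a plain wire to a Z-spider; every ground-spider has phase $0$; and every Z-spider is attached to at most one element altogether among the inputs, outputs and grounds (respectively, to at most one input and at most one ground, and any number of outputs). For a diagram $D$, let $I(D)$ be obtained by inserting, at each input and output attached to a Z-spider $v$ that is attached to at least two inputs, outputs or grounds, an identity: the input or output is moved to a new phase-$0$ Z-spider, which is connected by a Hadamard edge to a second new phase-$0$ Z-spider, itself connected by a Hadamard edge to $v$. Then: \begin{enumerate} \item Every ZX-ground diagram $D:n\to m$ is equivalent to a weakly graph-like diagram $D':n\to m$. \item If $D:n\to m$ is weakly graph-like, then $I(D):n\to m$ is strictly graph-like and equivalent to $D$. \item There is an algorithm turning an arbitrary ZX-ground diagram into an equivalent strictly graph-like one. Precisely, consider diagrams whose phases are formal expressions $q\pi+\sum_k c_k\theta_{j_k}$ with $q\in\mathbb Q$, $c_k\in\mathbb Z$ and indeterminates $\theta_0,\theta_1,\dots$, so that they are finite data. There is a computable map $W$ on such diagrams, for which $D\mapsto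 I(W(D))$ is computable too, such that for every $D:n\to m$ and all values of the indeterminates in $\mathbb R/2\pi\mathbb Z$, $W(D)$ is weakly graph-like, $I(W(D))$ is strictly graph-like, and both are diagrams $n\to m$ equivalent to $D$. \end{enumerate} -/

import Mathlib

/-! ZX-ground diagrams, their standard interpretation, and graph-like forms. -/

/-- The kinds of node of a ZX-ground diagram with phases in `P`: green (Z) and red (X) spiders,
Hadamard boxes, grounds, and the open ends (the `i`-th input, the `j`-th output). -/
inductive ZXKind (P : Type) : Type where
  | Z (α : P)
  | X (α : P)
  | had
  | gnd
  | inp (i : ℕ)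
  | out (j : ℕ)

namespace ZXKind

variable {P Q : Type}

def isZ : ZXKind P → Bool
  | Z _ => true
  | _ => false

/-- Inputs and outputs. -/
def isBoundary : ZXKind P → Bool
  | inp _ => true
  | out _ => true
  | _ => false

def isInput : ZXKind P → Bool
  | inp _ => true
  | _ => false

def isGround : ZXKind P → Bool
  | gnd => true
  | _ => false

/-- Inputs, outputs and grounds. -/
def isTerminal (k : ZXKind P) : Bool :=
  k.isBoundary || k.isGround

def map (f : P → Q) : ZXKind P → ZXKind Q
  | Z α => Z (f α)
  | X α => X (f α)
  | had => had
  | gnd => gnd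
  | inp i => inp i
  | out j => out j

def equivSum (P : Type) : ZXKind P ≃ (P ⊕ P) ⊕ (Bool ⊕ (ℕ ⊕ ℕ)) where
  toFun
    | Z α => .inl (.inl α)
    | X α => .inl (.inr α)
    | had => .inr (.inl false)
    | gnd => .inr (.inl true)
    | inp i => .inr (.inr (.inl i))
    | out j => .inr (.inr (.inr j))
  invFun
    | .inl (.inl α) => Z α
    | .inl (.inr α) => X α
    | .inr (.inl false) => had
    | .inr (.inl true) => gnd
    | .inr (.inr (.inl i)) => inp i
    | .inr (.inr (.inr j)) => out j
  left_inv k := by cases k <;> rfl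
  right_inv s := by rcases s with (_ | _) | (_ | _) | _ | _ <;> rfl

instance [Primcodable P] : Primcodable (ZXKind P) :=
  Primcodable.ofEquiv _ (equivSum P)

end ZXKind

/-- A ZX-ground diagram up to topological deformation, as a finite network: the wires are
`0, …, wires - 1`, and each node comes with the list of the wires attached to it
(a wire with both ends at the node is listed twice).  See `ZXDiagram.IsDiagram`. -/
structure ZXDiagram (P : Type) : Type where
  wires : ℕ
  nodes : List (ZXKind P × List ℕ)

namespace ZXDiagram

variable {P Q : Type}

def equivProd (P : Type) : ZXDiagram P ≃ ℕ × List (ZXKind P × List ℕ) where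
  toFun D := (D.wires, D.nodes)
  invFun p := ⟨p.1, p.2⟩
  left_inv _ := rfl
  right_inv _ := rfl

instance [Primcodable P] : Primcodable (ZXDiagram P) :=
  Primcodable.ofEquiv _ (equivProd P)

def map (f : P → Q) (D : ZXDiagram P) : ZXDiagram Q :=
  ⟨D.wires, D.nodes.map fun v => (v.1.map f, v.2)⟩

/-- The vertices of a diagram are the positions in its list of nodes. -/
abbrev Vert (D : ZXDiagram P) : Type := Fin D.nodes.length

def kind (D : ZXDiagram P) (v : D.Vert) : ZXKind P := (D.nodes.get v).1

def legs (D : ZXDiagram P) (v : D.Vert) : List ℕ := (D.nodes.get v).2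

/-- `D` is a well-formed diagram with `n` inputs and `m` outputs.  Spiders have arbitrary degree.
Every wire has two ends; a wire that meets no node is a closed circle. -/
structure IsDiagram (n m : ℕ) (D : ZXDiagram P) : Prop where
  legs_lt : ∀ v : D.Vert, ∀ w ∈ D.legs v, w < D.wires
  ends : ∀ w < D.wires,
    (D.nodes.flatMap Prod.snd).count w = 2 ∨ (D.nodes.flatMap Prod.snd).count w = 0
  had_deg : ∀ v : D.Vert, D.kind v = .had → (D.legs v).length = 2
  terminal_deg : ∀ v : D.Vert, (D.kind v).isTerminal → (D.legs v).length = 1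
  inp_lt : ∀ (v : D.Vert) (i : ℕ), D.kind v = .inp i → i < n
  inp_unique : ∀ i < n, ∃! v : D.Vert, D.kind v = .inp i
  out_lt : ∀ (v : D.Vert) (j : ℕ), D.kind v = .out j → j < m
  out_unique : ∀ j < m, ∃! v : D.Vert, D.kind v = .out j

/-! ### Standard interpretation -/

section Interpretation

open ComplexConjugate

/-- The entries of the Hadamard matrix. -/
noncomputable def hEntry (a b : Fin 2) : ℂ :=
  ((Real.sqrt 2 : ℝ) : ℂ)⁻¹ * (-1) ^ (a.val * b.val)

/-- The entries of `|0…0⟩⟨0…0| + e^{iα} |1…1⟩⟨1…1|`; without legs this is `1 + e^{iα}`. -/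
noncomputable def zTensor (α : Real.Angle) (l : List (Fin 2)) : ℂ :=
  (if ∀ a ∈ l, a = 0 then 1 else 0) + (if ∀ a ∈ l, a = 1 then (α.toCircle : ℂ) else 0)

/-- The entries of `|+…+⟩⟨+…+| + e^{iα} |-…-⟩⟨-…-|`. -/
noncomputable def xTensor (α : Real.Angle) (l : List (Fin 2)) : ℂ :=
  (l.map (hEntry 0)).prod + (α.toCircle : ℂ) * (l.map (hEntry 1)).prod

/-- The tensor of a node.  Each wire carries a pair of bits, the row and the column index of a
density matrix: a pure generator with matrix `A` stands for `ρ ↦ A ρ A†`, the ground is the trace.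
The inputs and outputs fix the values of their wires to the given row indices `x`, `y` and column
indices `x'`, `y'`. -/
noncomputable def nodeTensor {n m : ℕ} (x x' : Fin n → Fin 2) (y y' : Fin m → Fin 2) :
    ZXKind Real.Angle → List (Fin 2 × Fin 2) → ℂ
  | .Z α, l => zTensor α (l.map Prod.fst) * conj (zTensor α (l.map Prod.snd))
  | .X α, l => xTensor α (l.map Prod.fst) * conj (xTensor α (l.map Prod.snd))
  | .had, [p, q] => hEntry p.1 q.1 * conj (hEntry p.2 q.2)
  | .gnd, [p] => if p.1 = p.2 then 1 else 0
  | .inp i, [p] => if h : i < n then (if p = (x ⟨i, h⟩, x' ⟨i, h⟩) then 1 else 0) else 0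
  | .out j, [p] => if h : j < m then (if p = (y ⟨j, h⟩, y' ⟨j, h⟩) then 1 else 0) else 0
  | _, _ => 0

/-- Contraction of the network of tensors, by summation over the values of all the wires. -/
noncomputable def kernel (D : ZXDiagram Real.Angle) {n m : ℕ}
    (x x' : Fin n → Fin 2) (y y' : Fin m → Fin 2) : ℂ :=
  ∑ s : Fin D.wires → Fin 2 × Fin 2,
    (D.nodes.map fun v =>
      nodeTensor x x' y y' v.1
        (v.2.map fun w => if h : w < D.wires then s ⟨w, h⟩ else (0, 0))).prod

/-- The standard interpretation: a map from `2^n × 2^n` to `2^m × 2^m` complex matrices. -/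
noncomputable def interp (n m : ℕ) (D : ZXDiagram Real.Angle)
    (ρ : Matrix (Fin n → Fin 2) (Fin n → Fin 2) ℂ) :
    Matrix (Fin m → Fin 2) (Fin m → Fin 2) ℂ :=
  Matrix.of fun y y' => ∑ x, ∑ x', D.kernel x x' y y' * ρ x x'

/-- Equality of the interpretations up to a nonzero (positive) scalar. -/
def Equivalent (n m : ℕ) (D D' : ZXDiagram Real.Angle) : Prop :=
  ∃ c : ℝ, 0 < c ∧ ∀ ρ, D.interp n m ρ = (c : ℂ) • D'.interp n m ρ

end Interpretation

/-! ### Graph-like diagrams -/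

/-- A plain wire joins `u` and `v`. -/
def Wired (D : ZXDiagram P) (u v : D.Vert) : Prop :=
  ∃ w, (u ≠ v ∧ w ∈ D.legs u ∧ w ∈ D.legs v) ∨ (u = v ∧ 2 ≤ (D.legs u).count w)

/-- The Hadamard box `h` forms a Hadamard edge between the Z-spiders `u` and `v`. -/
def HadEdge (D : ZXDiagram P) (h u v : D.Vert) : Prop :=
  D.kind h = .had ∧ (D.kind u).isZ ∧ (D.kind v).isZ ∧
    ∃ a b, (D.legs h = [a, b] ∨ D.legs h = [b, a]) ∧ a ∈ D.legs u ∧ b ∈ D.legs v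

/-- `v` is a Z-spider attached to a ground. -/
def GroundSpider (D : ZXDiagram P) (v : D.Vert) : Prop :=
  (D.kind v).isZ ∧ ∃ g, (D.kind g).isGround ∧ D.Wired g v

/-- The conditions common to weakly and strictly graph-like diagrams. -/
structure GraphLikeCore [Zero P] (D : ZXDiagram P) : Prop where
  /-- All spiders are Z-spiders. -/
  no_X : ∀ (v : D.Vert) (α : P), D.kind v ≠ .X α
  /-- Z-spiders are not connected by plain wires. -/
  no_plain : ∀ u v : D.Vert, (D.kind u).isZ → (D.kind v).isZ → ¬ D.Wired u v
  /-- Hadamard boxes occur only as Hadamard edges between Z-spiders. -/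
  had_edge : ∀ h : D.Vert, D.kind h = .had → ∃ u v, D.HadEdge h u v
  /-- There are no closed circles. -/
  no_circle : ∀ w < D.wires, ∃ v : D.Vert, w ∈ D.legs v
  no_loop : ∀ h v : D.Vert, ¬ D.HadEdge h v v
  no_parallel : ∀ h h' u v : D.Vert, D.HadEdge h u v → D.HadEdge h' u v → h = h'
  /-- Ground-spiders are not connected to each other. -/
  ground_indep : ∀ h u v : D.Vert, D.HadEdge h u v → ¬ (D.GroundSpider u ∧ D.GroundSpider v)
  /-- Every input, output and ground is connected to a Z-spider. -/
  terminal_wired : ∀ b : D.Vert, (D.kind b).isTerminal → ∃ v, (D.kind v).isZ ∧ D.Wired b v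
  /-- Ground-spiders have phase `0`. -/
  ground_phase : ∀ (v : D.Vert) (α : P), D.kind v = .Z α → D.GroundSpider v → α = 0

/-- Each Z-spider has at most one input and at most one ground (and any number of outputs). -/
structure WeaklyGraphLike [Zero P] (D : ZXDiagram P) : Prop extends GraphLikeCore D where
  one_input : ∀ v b b' : D.Vert, (D.kind v).isZ → (D.kind b).isInput → (D.kind b').isInput →
    D.Wired b v → D.Wired b' v → b = b'
  one_ground : ∀ v g g' : D.Vert, (D.kind v).isZ → (D.kind g).isGround → (D.kind g').isGround →
    D.Wired g v → D.Wired g' v → g = g'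

/-- Each Z-spider is connected to at most one element altogether among the inputs, outputs and
grounds. -/
structure StrictlyGraphLike [Zero P] (D : ZXDiagram P) : Prop extends GraphLikeCore D where
  one_terminal : ∀ v b b' : D.Vert, (D.kind v).isZ →
    (D.kind b).isTerminal → (D.kind b').isTerminal → D.Wired b v → D.Wired b' v → b = b'

/-! ### Insertion of identity spiders -/

/-- The number of inputs, outputs and grounds attached to some wire in the list `l`. -/
def terminalCount (D : ZXDiagram P) (l : List ℕ) : ℕ :=
  (D.nodes.filter fun t => t.1.isTerminal && t.2.any fun w => decide (w ∈ l)).length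

/-- The wire `w` ends at a Z-spider attached to at least two inputs, outputs or grounds. -/
def crowded (D : ZXDiagram P) (w : ℕ) : Bool :=
  D.nodes.any fun v => v.1.isZ && decide (w ∈ v.2) && decide (2 ≤ D.terminalCount v.2)

/-- Append the node `v` of `D` to the diagram `E`.  If `v` is an input or output at a crowded
spider, two phase-`0` Z-spiders and two Hadamard edges are inserted between `v` and the spider,
using four fresh wires. -/
def insertStep [Zero P] (D E : ZXDiagram P) (v : ZXKind P × List ℕ) : ZXDiagram P :=
  if v.1.isBoundary && v.2.any D.crowded then
    ⟨E.wires + 4, E.nodes ++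
      [(v.1, [E.wires]),
       (.Z 0, [E.wires, E.wires + 1]),
       (.had, [E.wires + 1, E.wires + 2]),
       (.Z 0, [E.wires + 2, E.wires + 3]),
       (.had, [E.wires + 3] ++ v.2)]⟩
  else ⟨E.wires, E.nodes ++ [v]⟩

/-- Insert identity spiders at all the inputs and outputs of the spiders that are attached to at
least two inputs, outputs or grounds. -/
def insertIdentities [Zero P] (D : ZXDiagram P) : ZXDiagram P :=
  D.nodes.foldl (insertStep D) ⟨D.wires, []⟩

end ZXDiagram

/-! ### Symbolic phases -/

/-- A phase given as finite data: `q π + ∑ cₖ θ_{jₖ}` with `q` rational, `cₖ` integers, and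
`θ₀, θ₁, …` indeterminate real phases. -/
structure PhaseExpr : Type where
  piCoeff : ℚ
  terms : List (ℤ × ℕ)

namespace PhaseExpr

instance : Zero PhaseExpr := ⟨⟨0, []⟩⟩

def equivProd : PhaseExpr ≃ ℚ × List (ℤ × ℕ) where
  toFun e := (e.piCoeff, e.terms)
  invFun p := ⟨p.1, p.2⟩
  left_inv _ := rfl
  right_inv _ := rfl

instance : Primcodable PhaseExpr := Primcodable.ofEquiv _ equivProd

/-- The value of a phase expression when the indeterminates are the phases `θ`. -/
noncomputable def eval (θ : ℕ → Real.Angle) (e : PhaseExpr) : Real.Angle :=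
  (((e.piCoeff : ℝ) * Real.pi : ℝ) : Real.Angle) + (e.terms.map fun t => t.1 • θ t.2).sum

end PhaseExpr

/-! The algorithm is a single uniform construction, `expand`. Regard a diagram as a tensor network
whose tensors are the nodes and whose indices are the wires, and call an incidence of a node and a
wire a leg. Put one Z-spider, the core, in place of every node, one phase-0 Z-spider in place of
every wire, and a row of Hadamard edges in place of every leg; an input, output or ground is kept
and attached to its core by a plain wire, its port.

This preserves the interpretation because every node tensor factors through one doubled index `p`:
it is a sum over `p` of a weight times a product over the legs, each factor being the identity or a
Hadamard gate between `p` and the value of the wire (`nodeTensor_eq_sum`). A Z-spider has identities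
on its legs, an X-spider has Hadamard gates on all of them, and a Hadamard box is a phase-0 spider
with a gate on one of its two legs. As the Hadamard matrix squares to the identity, three edges in a
row realise a gate and two realise an identity. In the second case the spare third edge is isolated
and contributes the factor 2. Summing out the new wires therefore gives the original kernel times a
power of two (`kernel_assemble`, `IsDiagram.equivalent_expand`).

The shape is right because every row has at least two edges, so that it passes through spiders
belonging to that leg alone. Hence there are no loops and no parallel edges, even if the original
diagram has them, and no two cores are adjacent. Only cores carry ports, one at most, and the core
of a ground has phase 0. The result is already strictly graph-like, so inserting identities leaves
it unchanged (`insertIdentities_assemble`). The construction copies phases or writes 0 and never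
compares them. It thus commutes with the evaluation of symbolic phases (`map_expand`), and it is
primitive recursive.

For an arbitrary weakly graph-like diagram, an inserted identity contracts exactly to the identity,
again because the Hadamard matrix is an involution, so no scalar appears. Its shape is checked by
the same device as that of `expand`, a `Certificate`: each wire has one end at a Z-spider and one at
another node, and the wires are labelled by classes that are constant on each Z-spider. The
conditions on edges then become conditions on the classes of the two legs of each Hadamard box. -/

/-! ### Counting wire ends, and a criterion for graph-like diagrams -/

namespace ZXDiagram

variable {P : Type}

/-- The number of ends of the wire `w` at the nodes in `N` whose kind satisfies `p`. -/
def endCount (p : ZXKind P → Bool) (N : List (ZXKind P × List ℕ)) (w : ℕ) : ℕ :=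
  (N.map fun v => if p v.1 then v.2.count w else 0).sum

@[simp] lemma endCount_nil (p : ZXKind P → Bool) (w : ℕ) : endCount p [] w = 0 := rfl

@[simp] lemma endCount_cons (p : ZXKind P → Bool) (v : ZXKind P × List ℕ)
    (N : List (ZXKind P × List ℕ)) (w : ℕ) :
    endCount p (v :: N) w = (if p v.1 then v.2.count w else 0) + endCount p N w := by
  simp [endCount]

@[simp] lemma endCount_append (p : ZXKind P → Bool) (N M : List (ZXKind P × List ℕ)) (w : ℕ) :
    endCount p (N ++ M) w = endCount p N w + endCount p M w := by
  simp [endCount]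

lemma count_flatMap_legs (N : List (ZXKind P × List ℕ)) (w : ℕ) :
    (N.flatMap Prod.snd).count w =
      endCount ZXKind.isZ N w + endCount (fun k => !k.isZ) N w := by
  induction N with
  | nil => simp
  | cons v N ih =>
    rw [List.flatMap_cons, List.count_append, ih, endCount_cons, endCount_cons]
    cases v.1.isZ <;> simp <;> omega

lemma endCount_eq_sum (p : ZXKind P → Bool) (D : ZXDiagram P) (w : ℕ) :
    endCount p D.nodes w = ∑ v : D.Vert, if p (D.kind v) then (D.legs v).count w else 0 :=
  (Fin.sum_univ_fun_getElem D.nodes fun v => if p v.1 then v.2.count w else 0).symm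

lemma count_le_endCount {p : ZXKind P → Bool} {D : ZXDiagram P} {u : D.Vert}
    (hu : p (D.kind u)) (w : ℕ) : (D.legs u).count w ≤ endCount p D.nodes w := by
  rw [endCount_eq_sum]
  refine le_trans ?_ (Finset.single_le_sum (fun _ _ => Nat.zero_le _) (Finset.mem_univ u))
  simp [hu]

lemma add_count_le_endCount {p : ZXKind P → Bool} {D : ZXDiagram P} {u v : D.Vert} (huv : u ≠ v)
    (hu : p (D.kind u)) (hv : p (D.kind v)) (w : ℕ) :
    (D.legs u).count w + (D.legs v).count w ≤ endCount p D.nodes w := by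
  rw [endCount_eq_sum]
  refine le_trans ?_ (Finset.sum_le_sum_of_subset (Finset.subset_univ {u, v}))
  rw [Finset.sum_pair huv]
  simp [hu, hv]

lemma eq_of_endCount_le_one {p : ZXKind P → Bool} {D : ZXDiagram P} {u v : D.Vert} {w : ℕ}
    (h : endCount p D.nodes w ≤ 1) (hu : p (D.kind u)) (hv : p (D.kind v))
    (hwu : w ∈ D.legs u) (hwv : w ∈ D.legs v) : u = v := by
  by_contra huv
  have := add_count_le_endCount huv hu hv w
  have := List.count_pos_iff.2 hwu
  have := List.count_pos_iff.2 hwv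
  omega

lemma exists_of_endCount_pos {p : ZXKind P → Bool} {D : ZXDiagram P} {w : ℕ}
    (h : 0 < endCount p D.nodes w) : ∃ v : D.Vert, p (D.kind v) ∧ w ∈ D.legs v := by
  by_contra! hn
  rw [endCount_eq_sum, Finset.sum_eq_zero] at h
  · exact absurd h (lt_irrefl _)
  · intro v _
    split_ifs with hv
    · exact List.count_eq_zero.2 (hn v hv)
    · rfl

lemma mem_nodes (D : ZXDiagram P) (v : D.Vert) : (D.kind v, D.legs v) ∈ D.nodes :=
  List.get_mem D.nodes v

lemma exists_vert_of_mem {D : ZXDiagram P} {x : ZXKind P × List ℕ} (h : x ∈ D.nodes) :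
    ∃ v : D.Vert, D.kind v = x.1 ∧ D.legs v = x.2 := by
  obtain ⟨v, rfl⟩ := List.mem_iff_get.1 h
  exact ⟨v, rfl, rfl⟩

/-- Unique existence of a position becomes a count, which is additive over concatenation and
invariant under permutation; in this form the conditions on inputs and outputs pass through
constructions that reorder and append nodes. -/
lemma existsUnique_get_iff {α : Type} (p : α → Bool) (l : List α) :
    (∃! i : Fin l.length, p (l.get i)) ↔ l.countP p = 1 := by
  have h : l.countP p = (Finset.univ.filter fun i : Fin l.length => p (l.get i)).card := by
    rw [Finset.card_filter]
    simp only [List.get_eq_getElem]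
    rw [Fin.sum_univ_fun_getElem l (fun x => if p x then 1 else 0)]
    induction l with
    | nil => rfl
    | cons a l ih => rw [List.countP_cons, ih]; simp [add_comm]
  rw [h, Finset.card_eq_one, ExistsUnique]
  simp [Finset.eq_singleton_iff_unique_mem]

end ZXDiagram

/-! ### Predicates on the kinds of node -/

namespace ZXKind

variable {P Q : Type}

def isInp (i : ℕ) : ZXKind P → Bool
  | inp j => j == i
  | _ => false

def isOut (i : ℕ) : ZXKind P → Bool
  | out j => j == i
  | _ => false

lemma isInp_iff {i : ℕ} {k : ZXKind P} : k.isInp i = true ↔ k = .inp i := by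
  cases k <;> simp [isInp]

lemma isOut_iff {i : ℕ} {k : ZXKind P} : k.isOut i = true ↔ k = .out i := by
  cases k <;> simp [isOut]

lemma isZ_iff {k : ZXKind P} : k.isZ = true ↔ ∃ α, k = .Z α := by
  cases k <;> simp [isZ]

lemma isGround_iff {k : ZXKind P} : k.isGround = true ↔ k = .gnd := by
  cases k <;> simp [isGround]

lemma not_isZ_of_isTerminal {k : ZXKind P} (h : k.isTerminal) : k.isZ = false := by
  cases k <;> simp_all [isZ, isTerminal, isBoundary, isGround]

lemma isTerminal_of_isGround {k : ZXKind P} (h : k.isGround) : k.isTerminal := by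
  simp [isTerminal, h]

lemma isTerminal_of_isInput {k : ZXKind P} (h : k.isInput) : k.isTerminal := by
  cases k <;> simp_all [isInput, isTerminal, isBoundary]

end ZXKind

namespace ZXDiagram

variable {P : Type}

/-- Positions in the node list are not preserved by the constructions below, so well-formedness is
put in terms of members and counts. -/
lemma isDiagram_iff (n m : ℕ) (D : ZXDiagram P) :
    D.IsDiagram n m ↔
      (∀ x ∈ D.nodes, ∀ w ∈ x.2, w < D.wires) ∧
      (∀ w < D.wires, (D.nodes.flatMap Prod.snd).count w = 2 ∨
        (D.nodes.flatMap Prod.snd).count w = 0) ∧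
      (∀ x ∈ D.nodes, x.1 = .had → x.2.length = 2) ∧
      (∀ x ∈ D.nodes, x.1.isTerminal → x.2.length = 1) ∧
      (∀ x ∈ D.nodes, ∀ i, x.1 = .inp i → i < n) ∧
      (∀ i < n, D.nodes.countP (fun x => x.1.isInp i) = 1) ∧
      (∀ x ∈ D.nodes, ∀ j, x.1 = .out j → j < m) ∧
      (∀ j < m, D.nodes.countP (fun x => x.1.isOut j) = 1) := by
  simp only [← existsUnique_get_iff, ZXKind.isInp_iff, ZXKind.isOut_iff]
  constructor
  · intro h
    refine ⟨?_, h.ends, ?_, ?_, ?_, h.inp_unique, ?_, h.out_unique⟩ <;> intro x hx <;>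
      obtain ⟨v, h1, h2⟩ := exists_vert_of_mem hx <;> simp only [← h1, ← h2]
    · exact h.legs_lt v
    · exact h.had_deg v
    · exact h.terminal_deg v
    · exact h.inp_lt v
    · exact h.out_lt v
  · rintro ⟨h1, h2, h3, h4, h5, h6, h7, h8⟩
    exact ⟨fun v => h1 _ (D.mem_nodes v), h2, fun v => h3 _ (D.mem_nodes v),
      fun v => h4 _ (D.mem_nodes v), fun v => h5 _ (D.mem_nodes v), h6,
      fun v => h7 _ (D.mem_nodes v), h8⟩

/-- A labelling of the wires by classes which distinguishes the Z-spiders well enough to certify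
that a diagram is strictly graph-like. -/
structure Certificate [Zero P] {κ : Type} (D : ZXDiagram P) (cls : ℕ → κ) : Prop where
  legs_lt : ∀ x ∈ D.nodes, ∀ w ∈ x.2, w < D.wires
  z_ends : ∀ w < D.wires, endCount ZXKind.isZ D.nodes w = 1
  other_ends : ∀ w < D.wires, endCount (fun k => !k.isZ) D.nodes w = 1
  had_deg : ∀ x ∈ D.nodes, x.1 = .had → x.2.length = 2
  terminal_deg : ∀ x ∈ D.nodes, x.1.isTerminal → x.2.length = 1
  no_X : ∀ x ∈ D.nodes, ∀ α, x.1 ≠ .X α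
  cls_eq : ∀ x ∈ D.nodes, x.1.isZ → ∀ a ∈ x.2, ∀ b ∈ x.2, cls a = cls b
  had_ne : ∀ a b, (.had, [a, b]) ∈ D.nodes → cls a ≠ cls b
  had_pair : ∀ a b a' b', (.had, [a, b]) ∈ D.nodes → (.had, [a', b']) ∈ D.nodes →
    cls a = cls a' ∧ cls b = cls b' ∨ cls a = cls b' ∧ cls b = cls a' →
    ∃ w, w ∈ [a, b] ∧ w ∈ [a', b']
  ground : ∀ a b w w', (.had, [a, b]) ∈ D.nodes → (.gnd, [w]) ∈ D.nodes → (.gnd, [w']) ∈ D.nodes →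
    ¬ (cls w = cls a ∧ cls w' = cls b)
  phase : ∀ w α l, (.gnd, [w]) ∈ D.nodes → (.Z α, l) ∈ D.nodes → w ∈ l → α = 0
  one : ∀ k w k' w' l α, (k, [w]) ∈ D.nodes → (k', [w']) ∈ D.nodes → (.Z α, l) ∈ D.nodes →
    k.isTerminal → k'.isTerminal → w ∈ l → w' ∈ l → w = w'

/-! ### From a certificate to a strictly graph-like diagram -/

namespace Certificate

variable [Zero P] {κ : Type} {D : ZXDiagram P} {cls : ℕ → κ}

lemma exists_leg (c : D.Certificate cls) {b : D.Vert} (hb : (D.kind b).isTerminal) :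
    ∃ w, D.legs b = [w] :=
  List.length_eq_one_iff.1 (c.terminal_deg _ (D.mem_nodes b) hb)

lemma exists_wire (c : D.Certificate cls) {b v : D.Vert} (hb : (D.kind b).isTerminal)
    (hv : (D.kind v).isZ) (h : D.Wired b v) : ∃ w, D.legs b = [w] ∧ w ∈ D.legs v := by
  obtain ⟨w, hw⟩ := c.exists_leg hb
  obtain ⟨w', ⟨-, h1, h2⟩ | ⟨rfl, -⟩⟩ := h
  · rw [hw, List.mem_singleton] at h1
    exact ⟨w, hw, h1 ▸ h2⟩
  · rw [ZXKind.not_isZ_of_isTerminal hb] at hv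
    simp at hv

lemma exists_ground_wire (c : D.Certificate cls) {v : D.Vert} (h : D.GroundSpider v) :
    ∃ w, (.gnd, [w]) ∈ D.nodes ∧ w ∈ D.legs v := by
  obtain ⟨hv, g, hg, hgv⟩ := h
  obtain ⟨w, hw, hwv⟩ := c.exists_wire (ZXKind.isTerminal_of_isGround hg) hv hgv
  refine ⟨w, ?_, hwv⟩
  rw [← hw, ← ZXKind.isGround_iff.1 hg]
  exact D.mem_nodes g

omit [Zero P] in
lemma had_edge_cases {h u v : D.Vert} (e : D.HadEdge h u v) :
    ∃ a b, D.legs h = [a, b] ∧ (.had, [a, b]) ∈ D.nodes ∧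
      (a ∈ D.legs u ∧ b ∈ D.legs v ∨ b ∈ D.legs u ∧ a ∈ D.legs v) := by
  obtain ⟨hk, -, -, a, b, hl | hl, ha, hb⟩ := e
  · exact ⟨a, b, hl, by rw [← hk, ← hl]; exact D.mem_nodes h, .inl ⟨ha, hb⟩⟩
  · exact ⟨b, a, hl, by rw [← hk, ← hl]; exact D.mem_nodes h, .inr ⟨ha, hb⟩⟩

lemma class_eq (c : D.Certificate cls) {u : D.Vert} (hu : (D.kind u).isZ) {a b : ℕ}
    (ha : a ∈ D.legs u) (hb : b ∈ D.legs u) : cls a = cls b :=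
  c.cls_eq _ (D.mem_nodes u) hu a ha b hb

/-- A wire determines the Z-spider at one end and the other node at its other end. Since classes are
constant on each spider, a loop, a pair of parallel edges or an edge between ground-spiders would
give coincidences of classes that the certificate excludes. -/
theorem strictlyGraphLike (c : D.Certificate cls) : D.StrictlyGraphLike where
  no_X v := c.no_X _ (D.mem_nodes v)
  no_plain := by
    rintro u v hu hv ⟨w, ⟨huv, hwu, hwv⟩ | ⟨rfl, hw⟩⟩
    · exact huv (eq_of_endCount_le_one (c.z_ends w (c.legs_lt _ (D.mem_nodes u) w hwu)).le
        hu hv hwu hwv)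
    · have hwu : w ∈ D.legs u := List.count_pos_iff.1 (by omega)
      have h1 := c.z_ends w (c.legs_lt _ (D.mem_nodes u) w hwu)
      have h2 := count_le_endCount hu w
      omega
  had_edge h hh := by
    obtain ⟨a, b, hab⟩ : ∃ a b, D.legs h = [a, b] :=
      List.length_eq_two.1 (c.had_deg _ (D.mem_nodes h) hh)
    have hlt : ∀ w ∈ D.legs h, w < D.wires := c.legs_lt _ (D.mem_nodes h)
    simp only [hab, List.mem_cons, List.not_mem_nil, or_false, forall_eq_or_imp, forall_eq] at hlt
    obtain ⟨u, hu, hau⟩ := exists_of_endCount_pos (by rw [c.z_ends a hlt.1]; exact one_pos)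
    obtain ⟨v, hv, hbv⟩ := exists_of_endCount_pos (by rw [c.z_ends b hlt.2]; exact one_pos)
    exact ⟨u, v, hh, hu, hv, a, b, .inl hab, hau, hbv⟩
  no_circle w hw := by
    obtain ⟨u, -, hu⟩ := exists_of_endCount_pos (by rw [c.z_ends w hw]; exact one_pos)
    exact ⟨u, hu⟩
  no_loop h v e := by
    obtain ⟨a, b, -, hm, ⟨ha, hb⟩ | ⟨hb, ha⟩⟩ := had_edge_cases e <;>
      exact c.had_ne a b hm (c.class_eq e.2.1 ha hb)
  no_parallel h h' u v e e' := by
    obtain ⟨a, b, hl, hm, hab⟩ := had_edge_cases e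
    obtain ⟨a', b', hl', hm', hab'⟩ := had_edge_cases e'
    -- Parallel boxes see the same pair of classes, possibly in opposite order. The common wire
    -- obtained here identifies the boxes, because it has only one end at a node other than a
    -- Z-spider.
    obtain ⟨w, hw, hw'⟩ := c.had_pair a b a' b' hm hm' (by
      have hu := fun {x y} => c.class_eq e.2.1 (a := x) (b := y)
      have hv := fun {x y} => c.class_eq e.2.2.1 (a := x) (b := y)
      rcases hab with hab | hab <;> rcases hab' with hab' | hab'
      · exact .inl ⟨hu hab.1 hab'.1, hv hab.2 hab'.2⟩
      · exact .inr ⟨hu hab.1 hab'.1, hv hab.2 hab'.2⟩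
      · exact .inr ⟨hv hab.2 hab'.2, hu hab.1 hab'.1⟩
      · exact .inl ⟨hv hab.2 hab'.2, hu hab.1 hab'.1⟩)
    rw [← hl] at hw
    rw [← hl'] at hw'
    exact eq_of_endCount_le_one (c.other_ends w (c.legs_lt _ (D.mem_nodes h) w hw)).le
      (by rw [e.1]; rfl) (by rw [e'.1]; rfl) hw hw'
  ground_indep h u v e g := by
    obtain ⟨w, hw, hwu⟩ := c.exists_ground_wire g.1
    obtain ⟨w', hw', hwv⟩ := c.exists_ground_wire g.2
    obtain ⟨a, b, -, hm, ⟨ha, hb⟩ | ⟨hb, ha⟩⟩ := had_edge_cases e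
    · exact c.ground a b w w' hm hw hw' ⟨c.class_eq e.2.1 hwu ha, c.class_eq e.2.2.1 hwv hb⟩
    · exact c.ground a b w' w hm hw' hw ⟨c.class_eq e.2.2.1 hwv ha, c.class_eq e.2.1 hwu hb⟩
  terminal_wired b hb := by
    obtain ⟨w, hw⟩ := c.exists_leg hb
    have hwb : w ∈ D.legs b := by simp [hw]
    obtain ⟨v, hv, hwv⟩ := exists_of_endCount_pos
      (by rw [c.z_ends w (c.legs_lt _ (D.mem_nodes b) w hwb)]; exact one_pos)
    refine ⟨v, hv, w, .inl ⟨?_, hwb, hwv⟩⟩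
    rintro rfl
    rw [ZXKind.not_isZ_of_isTerminal hb] at hv
    simp at hv
  ground_phase v α hv g := by
    obtain ⟨w, hw, hwv⟩ := c.exists_ground_wire g
    exact c.phase w α _ hw (hv ▸ D.mem_nodes v) hwv
  one_terminal v b b' hv hb hb' h h' := by
    obtain ⟨w, hw, hwv⟩ := c.exists_wire hb hv h
    obtain ⟨w', hw', hwv'⟩ := c.exists_wire hb' hv h'
    obtain ⟨α, hα⟩ := ZXKind.isZ_iff.1 hv
    have : w = w' := c.one _ w _ w' _ α (hw ▸ D.mem_nodes b) (hw' ▸ D.mem_nodes b')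
      (hα ▸ D.mem_nodes v) hb hb' hwv hwv'
    subst this
    exact eq_of_endCount_le_one
      (c.other_ends w (c.legs_lt _ (D.mem_nodes v) w hwv)).le
      (by simp [ZXKind.not_isZ_of_isTerminal hb]) (by simp [ZXKind.not_isZ_of_isTerminal hb'])
      (by simp [hw]) (by simp [hw'])

end Certificate

lemma StrictlyGraphLike.weaklyGraphLike [Zero P] {D : ZXDiagram P} (h : D.StrictlyGraphLike) :
    D.WeaklyGraphLike where
  toGraphLikeCore := h.toGraphLikeCore
  one_input v b b' hv hb hb' := h.one_terminal v b b' hv (ZXKind.isTerminal_of_isInput hb)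
    (ZXKind.isTerminal_of_isInput hb')
  one_ground v b b' hv hb hb' := h.one_terminal v b b' hv (ZXKind.isTerminal_of_isGround hb)
    (ZXKind.isTerminal_of_isGround hb')

end ZXDiagram

/-! ### Insertion of identity spiders: the result is strictly graph-like -/

namespace ZXDiagram

variable {P : Type}

/-! ### Wire ends in weakly graph-like diagrams -/

section WeaklyGraphLike

variable [Zero P] {n m : ℕ} {D : ZXDiagram P}

/-- There are two ends in all, as there are no circles. They are not both at Z-spiders, as those are
never joined by plain wires. One of them is, since any other node is a Hadamard box or a terminal,
and every wire of these leads to a Z-spider. -/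
lemma WeaklyGraphLike.ends (hD : D.IsDiagram n m) (hw : D.WeaklyGraphLike) {w : ℕ}
    (hlt : w < D.wires) :
    endCount ZXKind.isZ D.nodes w = 1 ∧ endCount (fun k => !k.isZ) D.nodes w = 1 := by
  have htot : endCount ZXKind.isZ D.nodes w + endCount (fun k => !k.isZ) D.nodes w = 2 := by
    rw [← count_flatMap_legs]
    refine (hD.ends w hlt).resolve_right fun h0 => ?_
    obtain ⟨v, hv⟩ := hw.no_circle w hlt
    exact List.count_eq_zero.1 h0 (List.mem_flatMap.2 ⟨_, D.mem_nodes v, hv⟩)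
  have hle : endCount ZXKind.isZ D.nodes w ≤ 1 := by
    by_contra! h2
    obtain ⟨v, hv, hwv⟩ := exists_of_endCount_pos (by omega : 0 < endCount ZXKind.isZ D.nodes w)
    have hone : (D.legs v).count w = 1 := by
      have := List.count_pos_iff.2 hwv
      by_contra hne
      exact hw.no_plain v v hv hv ⟨w, .inr ⟨rfl, by omega⟩⟩
    rw [endCount_eq_sum, ← Finset.add_sum_erase _ _ (Finset.mem_univ v), if_pos hv, hone] at h2
    obtain ⟨u, hu, hne⟩ := Finset.exists_ne_zero_of_sum_ne_zero
      (s := Finset.univ.erase v) (f := fun v => if (D.kind v).isZ then (D.legs v).count w else 0)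
      (by omega)
    split_ifs at hne with huz
    · exact hw.no_plain u v huz hv ⟨w, .inl ⟨(Finset.mem_erase.1 hu).1,
        List.count_pos_iff.1 (Nat.pos_of_ne_zero hne), hwv⟩⟩
    · exact hne rfl
  have hpos : 0 < endCount ZXKind.isZ D.nodes w := by
    by_contra h0
    obtain ⟨v, hv, hwv⟩ := exists_of_endCount_pos
      (by omega : 0 < endCount (fun k => !k.isZ) D.nodes w)
    have key : ∃ u, (D.kind u).isZ ∧ w ∈ D.legs u := by
      cases hk : D.kind v with
      | Z α => simp [hk, ZXKind.isZ] at hv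
      | X α => exact absurd hk (hw.no_X v α)
      | had =>
        obtain ⟨u, u', -, hu, hu', a, b, hl, ha, hb⟩ := hw.had_edge v hk
        have : w = a ∨ w = b := by
          rcases hl with hl | hl <;> simp [hl] at hwv <;> tauto
        rcases this with rfl | rfl
        · exact ⟨u, hu, ha⟩
        · exact ⟨u', hu', hb⟩
      | _ =>
        have ht : (D.kind v).isTerminal := by simp [hk, ZXKind.isTerminal, ZXKind.isBoundary,
          ZXKind.isGround]
        obtain ⟨w', hw'⟩ := List.length_eq_one_iff.1 (hD.terminal_deg v ht)
        obtain ⟨u, hu, w'', ⟨-, h1, h2⟩ | ⟨rfl, -⟩⟩ := hw.terminal_wired v ht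
        · rw [hw', List.mem_singleton] at h1 hwv
          exact ⟨u, hu, by rw [hwv, ← h1]; exact h2⟩
        · simp [hu] at hv
    obtain ⟨u, hu, hwu⟩ := key
    have h1 := count_le_endCount hu w
    have h2 := List.count_pos_iff.2 hwu
    omega
  omega

/-- The Z-spiders at which the wire `w` ends. -/
def zSpidersAt (D : ZXDiagram P) (w : ℕ) : Set D.Vert := {v | (D.kind v).isZ ∧ w ∈ D.legs v}

lemma WeaklyGraphLike.zSpidersAt_eq (hD : D.IsDiagram n m) (hw : D.WeaklyGraphLike) {v : D.Vert}
    (hv : (D.kind v).isZ) {w : ℕ} (hwv : w ∈ D.legs v) : D.zSpidersAt w = {v} := by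
  ext u
  simp only [zSpidersAt, Set.mem_ofPred_eq, Set.mem_singleton_iff]
  constructor
  · rintro ⟨hu, hwu⟩
    exact eq_of_endCount_le_one (hw.ends hD (hD.legs_lt v w hwv)).1.le hu hv hwu hwv
  · rintro rfl
    exact ⟨hv, hwv⟩

lemma WeaklyGraphLike.exists_zSpider (hD : D.IsDiagram n m) (hw : D.WeaklyGraphLike) {w : ℕ}
    (hlt : w < D.wires) : ∃ v, (D.kind v).isZ ∧ w ∈ D.legs v ∧ D.zSpidersAt w = {v} := by
  obtain ⟨v, hv, hwv⟩ := exists_of_endCount_pos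
    (by rw [(hw.ends hD hlt).1]; exact one_pos : 0 < endCount ZXKind.isZ D.nodes w)
  exact ⟨v, hv, hwv, hw.zSpidersAt_eq hD hv hwv⟩

lemma WeaklyGraphLike.exists_hadEdge (hD : D.IsDiagram n m) (hw : D.WeaklyGraphLike) {a b : ℕ}
    (h : (.had, [a, b]) ∈ D.nodes) : ∃ e u v, D.HadEdge e u v ∧ D.legs e = [a, b] ∧
      D.zSpidersAt a = {u} ∧ D.zSpidersAt b = {v} := by
  obtain ⟨e, hk, hl⟩ := exists_vert_of_mem h
  have hlt := hD.legs_lt e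
  simp only [hl, List.mem_cons, List.not_mem_nil, or_false, forall_eq_or_imp, forall_eq] at hlt
  obtain ⟨u, hu, hau, hsu⟩ := hw.exists_zSpider hD hlt.1
  obtain ⟨v, hv, hbv, hsv⟩ := hw.exists_zSpider hD hlt.2
  exact ⟨e, u, v, ⟨hk, hu, hv, a, b, .inl hl, hau, hbv⟩, hl, hsu, hsv⟩

omit [Zero P] in
lemma groundSpider_of_gnd {w : ℕ} (h : (.gnd, [w]) ∈ D.nodes) {v : D.Vert}
    (hv : D.zSpidersAt w = {v}) : D.GroundSpider v := by
  obtain ⟨g, hg, hl⟩ := exists_vert_of_mem h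
  have hvz : v ∈ D.zSpidersAt w := by rw [hv]; rfl
  simp only at hg hl
  refine ⟨hvz.1, g, by rw [hg]; rfl, w, .inl ⟨?_, by simp [hl], hvz.2⟩⟩
  rintro rfl
  have := hvz.1
  simp [hg, ZXKind.isZ] at this

end WeaklyGraphLike

/-- The node `v` is an input or output at a crowded spider. -/
def isReplaced (D : ZXDiagram P) (v : ZXKind P × List ℕ) : Bool :=
  v.1.isBoundary && v.2.any D.crowded

/-- The nodes which replace a boundary node `v`, with fresh wires `b, …, b + 3`. -/
def identityNodes [Zero P] (b : ℕ) (v : ZXKind P × List ℕ) : List (ZXKind P × List ℕ) :=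
  [(v.1, [b]), (.Z 0, [b, b + 1]), (.had, [b + 1, b + 2]), (.Z 0, [b + 2, b + 3]),
    (.had, [b + 3] ++ v.2)]

/-! ### Nodes and wire ends after inserting identities -/

section Insert

variable [Zero P] (D : ZXDiagram P)

lemma insertStep_eq (E : ZXDiagram P) (v : ZXKind P × List ℕ) :
    insertStep D E v = if D.isReplaced v then ⟨E.wires + 4, E.nodes ++ identityNodes E.wires v⟩
      else ⟨E.wires, E.nodes ++ [v]⟩ := rfl

lemma wires_le_foldl_insertStep (N : List (ZXKind P × List ℕ)) (E : ZXDiagram P) :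
    E.wires ≤ (N.foldl (insertStep D) E).wires := by
  induction N generalizing E with
  | nil => exact le_rfl
  | cons v N ih =>
    refine le_trans ?_ (ih _)
    rw [insertStep_eq]
    split_ifs <;> simp

/-- Each replacement uses up four wire numbers, so the fresh blocks begin at offsets divisible by 4
from the initial number of wires. This makes the residue of a fresh wire show its place in its
block. -/
lemma mem_foldl_insertStep (N : List (ZXKind P × List ℕ)) (E : ZXDiagram P)
    {x : ZXKind P × List ℕ} (hx : x ∈ (N.foldl (insertStep D) E).nodes) :
    x ∈ E.nodes ∨ (x ∈ N ∧ D.isReplaced x = false) ∨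
      ∃ v ∈ N, D.isReplaced v ∧ ∃ k, x ∈ identityNodes (E.wires + 4 * k) v ∧
        E.wires + 4 * k + 4 ≤ (N.foldl (insertStep D) E).wires := by
  induction N generalizing E with
  | nil => exact .inl hx
  | cons v N ih =>
    rw [List.foldl_cons] at hx ⊢
    have hle := D.wires_le_foldl_insertStep N (insertStep D E v)
    have hcases := ih _ hx
    rw [insertStep_eq] at hcases hle ⊢
    by_cases hv : D.isReplaced v
    · simp only [hv, if_true, List.mem_append] at hcases hle ⊢
      rcases hcases with (h | h) | ⟨h, h'⟩ | ⟨u, hu, hr, k, hk, hkl⟩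
      · exact .inl h
      · exact .inr (.inr ⟨v, by simp, hv, 0, by simpa using h, by simpa using hle⟩)
      · exact .inr (.inl ⟨by simp [h], h'⟩)
      · refine .inr (.inr ⟨u, by simp [hu], hr, k + 1, ?_, ?_⟩)
        · rwa [show E.wires + 4 * (k + 1) = E.wires + 4 + 4 * k by ring]
        · omega
    · rw [if_neg hv] at hcases hle ⊢
      simp only [List.mem_append, List.mem_singleton] at hcases
      rcases hcases with (h | rfl) | ⟨h, h'⟩ | ⟨u, hu, hr, k, hk⟩
      · exact .inl h
      · exact .inr (.inl ⟨by simp, by simpa using hv⟩)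
      · exact .inr (.inl ⟨by simp [h], h'⟩)
      · exact .inr (.inr ⟨u, by simp [hu], hr, k, hk⟩)

omit [Zero P] in
lemma isZ_eq_false_of_isReplaced {v : ZXKind P × List ℕ} (h : D.isReplaced v) :
    v.1.isZ = false := by
  obtain ⟨k, l⟩ := v
  cases k <;> simp_all [isReplaced, ZXKind.isBoundary, ZXKind.isZ]

omit [Zero P] in
lemma count_fresh (b w : ℕ) : ([b, b + 1, b + 2, b + 3]).count w =
    if b ≤ w ∧ w < b + 4 then 1 else 0 := by
  simp only [List.count_cons, List.count_nil, beq_iff_eq]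
  split_ifs <;> omega

/-- The old leg passes from `v` to the last Hadamard box, neither of which is a Z-spider, and every
fresh wire runs between a Z-spider and another node. Hence both counts keep their old part and gain
one on each fresh wire. -/
lemma endCount_identityNodes {p : ZXKind P → Bool} (hp : p = ZXKind.isZ ∨ p = fun k => !k.isZ)
    {v : ZXKind P × List ℕ} (hv : v.1.isZ = false) (b w : ℕ) :
    endCount p (identityNodes b v) w =
      endCount p [v] w + if b ≤ w ∧ w < b + 4 then 1 else 0 := by
  rw [← count_fresh]
  have hZ : (ZXKind.Z (0 : P)).isZ = true := rfl
  have hh : (ZXKind.had : ZXKind P).isZ = false := rfl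
  rcases hp with rfl | rfl
  · simp only [identityNodes, endCount_cons, hv, hZ, hh, endCount_nil, List.count_cons]
    simp
    omega
  · simp only [identityNodes, endCount_cons, hv, hZ, hh, endCount_nil, List.count_cons,
      List.cons_append, List.nil_append]
    simp
    omega

lemma endCount_foldl_insertStep {p : ZXKind P → Bool}
    (hp : p = ZXKind.isZ ∨ p = fun k => !k.isZ) (N : List (ZXKind P × List ℕ))
    (E : ZXDiagram P) (w : ℕ) :
    endCount p (N.foldl (insertStep D) E).nodes w = endCount p E.nodes w + endCount p N w +
      if E.wires ≤ w ∧ w < (N.foldl (insertStep D) E).wires then 1 else 0 := by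
  induction N generalizing E with
  | nil =>
    rw [if_neg (by simp)]
    simp
  | cons v N ih =>
    rw [List.foldl_cons, ih]
    have hle := D.wires_le_foldl_insertStep N (insertStep D E v)
    rw [insertStep_eq] at hle ⊢
    by_cases hv : D.isReplaced v
    · simp only [hv, if_true] at hle ⊢
      rw [endCount_append, endCount_identityNodes hp (D.isZ_eq_false_of_isReplaced hv),
        endCount_cons (v := v), endCount_cons (v := v), endCount_nil]
      split_ifs <;> omega
    · simp only [hv] at hle ⊢
      rw [if_neg Bool.false_ne_true] at hle ⊢
      rw [endCount_append, endCount_cons (v := v), endCount_cons (v := v), endCount_nil]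
      simp only
      split_ifs <;> omega

lemma countP_foldl_insertStep {p : ZXKind P → Bool} (hZ : p (.Z 0) = false)
    (hh : p .had = false) (N : List (ZXKind P × List ℕ)) (E : ZXDiagram P) :
    (N.foldl (insertStep D) E).nodes.countP (fun x => p x.1) =
      E.nodes.countP (fun x => p x.1) + N.countP fun x => p x.1 := by
  induction N generalizing E with
  | nil => simp
  | cons v N ih =>
    rw [List.foldl_cons, ih, insertStep_eq, List.countP_cons]
    split_ifs <;>
    simp [identityNodes, *] <;> omega

variable {D}

omit [Zero P] in
lemma isDiagram_legs {n m : ℕ} (hD : D.IsDiagram n m) {x : ZXKind P × List ℕ} (hx : x ∈ D.nodes) :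
    ∀ w ∈ x.2, w < D.wires :=
  ((isDiagram_iff n m D).1 hD).1 x hx

lemma mem_insertIdentities {n m : ℕ} (hD : D.IsDiagram n m) {x : ZXKind P × List ℕ}
    (hx : x ∈ D.insertIdentities.nodes) :
    (x ∈ D.nodes ∧ D.isReplaced x = false) ∨
      ∃ v w k, (v, [w]) ∈ D.nodes ∧ v.isBoundary ∧ w < D.wires ∧
        x ∈ identityNodes (D.wires + 4 * k) (v, [w]) ∧
        D.wires + 4 * k + 4 ≤ D.insertIdentities.wires := by
  rcases D.mem_foldl_insertStep _ _ hx with h | h | ⟨⟨v, l⟩, hv, hr, k, hk, hle⟩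
  · simp at h
  · exact .inl h
  · have hb : v.isBoundary := (Bool.and_eq_true_iff.1 hr).1
    obtain ⟨w, rfl⟩ : ∃ w, l = [w] := List.length_eq_one_iff.1
      (((isDiagram_iff n m D).1 hD).2.2.2.1 _ hv (by simp [ZXKind.isTerminal, hb]))
    exact .inr ⟨v, w, k, hv, hb, isDiagram_legs hD hv w (by simp), hk, hle⟩

lemma had_mem_insertIdentities {n m : ℕ} (hD : D.IsDiagram n m) {a b : ℕ}
    (h : (.had, [a, b]) ∈ D.insertIdentities.nodes) :
    ((.had, [a, b]) ∈ D.nodes ∧ a < D.wires ∧ b < D.wires) ∨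
    ∃ k, a = D.wires + 4 * k + 1 ∧ b = D.wires + 4 * k + 2 ∨
      a = D.wires + 4 * k + 3 ∧ b < D.wires := by
  rcases mem_insertIdentities hD h with ⟨h, -⟩ | ⟨v, w, k, -, hb, hw, hx, -⟩
  · have := isDiagram_legs hD h
    simp only [List.mem_cons, List.not_mem_nil, or_false, forall_eq_or_imp, forall_eq] at this
    exact .inl ⟨h, this⟩
  · refine .inr ⟨k, ?_⟩
    cases v <;> simp [identityNodes, ZXKind.isBoundary] at hx hb <;> omega

lemma gnd_mem_insertIdentities {n m : ℕ} (hD : D.IsDiagram n m) {w : ℕ}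
    (h : (.gnd, [w]) ∈ D.insertIdentities.nodes) : (.gnd, [w]) ∈ D.nodes ∧ w < D.wires := by
  rcases mem_insertIdentities hD h with ⟨h, -⟩ | ⟨v, w, k, -, hb, hw, hx, -⟩
  · exact ⟨h, isDiagram_legs hD h w (by simp)⟩
  · cases v <;> simp [identityNodes, ZXKind.isBoundary] at hx hb

lemma terminal_mem_insertIdentities {n m : ℕ} (hD : D.IsDiagram n m) {t : ZXKind P}
    (ht : t.isTerminal) {w : ℕ} (h : (t, [w]) ∈ D.insertIdentities.nodes) :
    ((t, [w]) ∈ D.nodes ∧ D.isReplaced (t, [w]) = false ∧ w < D.wires) ∨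
      ∃ k, w = D.wires + 4 * k := by
  rcases mem_insertIdentities hD h with h | ⟨v, w', k, -, hb, hw, hx, -⟩
  · exact .inl ⟨h.1, h.2, isDiagram_legs hD h.1 w (by simp)⟩
  · refine .inr ⟨k, ?_⟩
    simp only [identityNodes, List.mem_cons, Prod.mk.injEq, List.cons.injEq] at hx
    rcases hx with ⟨-, rfl, -⟩ | hx | hx | hx | hx
    · rfl
    all_goals simp [hx, ZXKind.isTerminal, ZXKind.isBoundary, ZXKind.isGround] at ht hx

lemma Z_mem_insertIdentities {n m : ℕ} (hD : D.IsDiagram n m) {α : P} {l : List ℕ}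
    (h : (.Z α, l) ∈ D.insertIdentities.nodes) :
    (.Z α, l) ∈ D.nodes ∨
      ∃ k, l = [D.wires + 4 * k, D.wires + 4 * k + 1] ∨
        l = [D.wires + 4 * k + 2, D.wires + 4 * k + 3] := by
  rcases mem_insertIdentities hD h with h | ⟨v, w', k, -, hb, hw, hx, -⟩
  · exact .inl h.1
  · refine .inr ⟨k, ?_⟩
    cases v <;> simp [identityNodes, ZXKind.isBoundary] at hx hb <;> tauto

/-- The classes of the wires of `D.insertIdentities`: an old wire is classified by the Z-spider at
its end, the fresh wires come in pairs. -/
def insertClass (D : ZXDiagram P) (w : ℕ) : Set D.Vert ⊕ ℕ :=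
  if w < D.wires then .inl (D.zSpidersAt w) else .inr ((w - D.wires) / 2)

omit [Zero P] in
lemma insertClass_old {w : ℕ} (h : w < D.wires) : D.insertClass w = .inl (D.zSpidersAt w) :=
  if_pos h

omit [Zero P] in
lemma insertClass_new (i : ℕ) : D.insertClass (D.wires + i) = .inr (i / 2) := by
  rw [insertClass, if_neg (by omega), Nat.add_sub_cancel_left]

omit [Zero P] in
lemma two_le_terminalCount {k k' : ZXKind P} {w w' : ℕ} {l : List ℕ} (h : (k, [w]) ∈ D.nodes)
    (h' : (k', [w']) ∈ D.nodes) (ht : k.isTerminal) (ht' : k'.isTerminal) (hw : w ∈ l)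
    (hw' : w' ∈ l) (hne : w ≠ w') : 2 ≤ D.terminalCount l := by
  classical
  have hnd : ([(k, [w]), (k', [w'])] : List (ZXKind P × List ℕ)).Nodup := by simp [hne]
  refine (List.Nodup.subperm hnd ?_).length_le
  intro x hx
  simp only [List.mem_cons, List.not_mem_nil, or_false] at hx
  rcases hx with rfl | rfl <;> simp [List.mem_filter, *]

/-- The class of an old wire is the singleton of its Z-spider, so edges between old wires inherit
their conditions from `D`. Any other edge has an end in a fresh class, which no old wire has and
which determines the block. -/
theorem WeaklyGraphLike.certificate {n m : ℕ} (hD : D.IsDiagram n m) (hw : D.WeaklyGraphLike) :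
    D.insertIdentities.Certificate D.insertClass := by
  have hD' := (isDiagram_iff n m D).1 hD
  have hle : D.wires ≤ D.insertIdentities.wires := D.wires_le_foldl_insertStep _ ⟨D.wires, []⟩
  have hends (p : ZXKind P → Bool) (hp : p = ZXKind.isZ ∨ p = fun k => !k.isZ) (w : ℕ)
      (hlt : w < D.insertIdentities.wires) : endCount p D.insertIdentities.nodes w = 1 := by
    rw [insertIdentities, D.endCount_foldl_insertStep hp]
    change 0 + endCount p D.nodes w +
      (if D.wires ≤ w ∧ w < D.insertIdentities.wires then 1 else 0) = 1
    by_cases hwD : w < D.wires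
    · rw [if_neg (by omega)]
      rcases hp with rfl | rfl
      · simpa using (hw.ends hD hwD).1
      · simpa using (hw.ends hD hwD).2
    · rw [if_pos (by omega)]
      -- A fresh wire has no end in the original diagram; its only ends are those counted by the
      -- fold.
      have : w ∉ D.nodes.flatMap Prod.snd := fun h => by
        obtain ⟨x, hx, hwx⟩ := List.mem_flatMap.1 h
        exact hwD (hD'.1 x hx w hwx)
      have := List.count_eq_zero.2 this
      rw [count_flatMap_legs] at this
      rcases hp with rfl | rfl <;> omega
  refine
    { legs_lt := ?_
      z_ends := hends _ (.inl rfl)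
      other_ends := hends _ (.inr rfl)
      had_deg := ?_
      terminal_deg := ?_
      no_X := ?_
      cls_eq := ?_
      had_ne := ?_
      had_pair := ?_
      ground := ?_
      phase := ?_
      one := ?_ }
  · intro x hx
    rcases mem_insertIdentities hD hx with ⟨h, -⟩ | ⟨v, w', k, -, hb, hw, hx, hle⟩
    · exact fun w hw => (isDiagram_legs hD h w hw).trans_le hle
    · simp only [identityNodes, List.mem_cons, List.not_mem_nil, or_false] at hx
      rcases hx with rfl | rfl | rfl | rfl | rfl <;> simp <;> omega
  · intro x hx
    rcases mem_insertIdentities hD hx with ⟨h, -⟩ | ⟨v, w', k, -, hb, hw, hx, hle⟩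
    · exact hD'.2.2.1 x h
    · cases v <;> simp [ZXKind.isBoundary] at hb <;> simp [identityNodes] at hx <;>
      rcases hx with rfl | rfl | rfl | rfl | rfl <;> simp
  · intro x hx
    rcases mem_insertIdentities hD hx with ⟨h, -⟩ | ⟨v, w', k, -, hb, hw, hx, hle⟩
    · exact hD'.2.2.2.1 x h
    · simp only [identityNodes, List.mem_cons, List.not_mem_nil, or_false] at hx
      rcases hx with rfl | rfl | rfl | rfl | rfl <;>
      simp [ZXKind.isTerminal, ZXKind.isBoundary, ZXKind.isGround]
  · intro x hx α
    rcases mem_insertIdentities hD hx with ⟨h, -⟩ | ⟨v, w', k, -, hb, hw, hx, hle⟩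
    · obtain ⟨v, hv, -⟩ := exists_vert_of_mem h
      exact hv ▸ hw.no_X v α
    · cases v <;> simp [ZXKind.isBoundary] at hb <;> simp [identityNodes] at hx <;>
      rcases hx with rfl | rfl | rfl | rfl | rfl <;> simp
  · rintro ⟨k, l⟩ hx hz a ha b hb
    obtain ⟨α, rfl⟩ := ZXKind.isZ_iff.1 hz
    simp only at ha hb
    rcases Z_mem_insertIdentities hD hx with h | ⟨k, rfl | rfl⟩
    · obtain ⟨v, hv, hl⟩ := exists_vert_of_mem h
      simp only at hv hl
      rw [insertClass_old (isDiagram_legs hD h a ha), insertClass_old (isDiagram_legs hD h b hb),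
        hw.zSpidersAt_eq hD (v := v) (by rw [hv]; rfl) (by rwa [hl]),
        hw.zSpidersAt_eq hD (v := v) (by rw [hv]; rfl) (by rwa [hl])]
    all_goals
      simp only [List.mem_cons, List.not_mem_nil, or_false] at ha hb
      rcases ha with rfl | rfl <;> rcases hb with rfl | rfl <;>
      simp only [add_assoc, insertClass_new, Sum.inr.injEq] <;> omega
  · intro a b h
    rcases had_mem_insertIdentities hD h with ⟨h, ha, hb⟩ | ⟨k, ⟨rfl, rfl⟩ | ⟨rfl, hb⟩⟩
    · obtain ⟨e, u, v, he, -, hu, hv⟩ := hw.exists_hadEdge hD h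
      rw [insertClass_old ha, insertClass_old hb, hu, hv]
      simp only [ne_eq, Sum.inl.injEq, Set.singleton_eq_singleton_iff]
      rintro rfl
      exact hw.no_loop e u he
    · simp only [add_assoc, insertClass_new, ne_eq, Sum.inr.injEq]
      omega
    · simp [add_assoc, insertClass_new, insertClass_old hb]
  · intro a b a' b' h h'
    rcases had_mem_insertIdentities hD h with ⟨h, ha, hb⟩ | ⟨k, ⟨rfl, rfl⟩ | ⟨rfl, hb⟩⟩ <;>
    rcases had_mem_insertIdentities hD h' with ⟨h', ha', hb'⟩ | ⟨k', ⟨rfl, rfl⟩ | ⟨rfl, hb'⟩⟩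
    · obtain ⟨e, u, v, he, hl, hu, hv⟩ := hw.exists_hadEdge hD h
      obtain ⟨e', u', v', he', hl', hu', hv'⟩ := hw.exists_hadEdge hD h'
      rw [insertClass_old ha, insertClass_old hb, insertClass_old ha', insertClass_old hb',
        hu, hv, hu', hv']
      simp only [Sum.inl.injEq, Set.singleton_eq_singleton_iff]
      intro hc
      have : e = e' := by
        rcases hc with ⟨rfl, rfl⟩ | ⟨rfl, rfl⟩
        · exact hw.no_parallel e e' u v he he'
        · obtain ⟨g1, g2, g3, x, y, g4, g5, g6⟩ := he'
          exact hw.no_parallel e e' u v he ⟨g1, g3, g2, y, x, g4.symm, g6, g5⟩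
      subst this
      exact ⟨a, by simp, by rw [← hl', hl]; simp⟩
    all_goals
      simp only [add_assoc, insertClass_new, insertClass_old, *, reduceCtorEq, Sum.inr.injEq,
        false_and, and_false, or_self, false_imp_iff, List.mem_cons, List.not_mem_nil, or_false,
        exists_eq_or_imp, exists_eq_left]
    all_goals omega
  · rintro a b w w' h hg hg' ⟨e1, e2⟩
    obtain ⟨hg, hlt⟩ := gnd_mem_insertIdentities hD hg
    obtain ⟨hg', hlt'⟩ := gnd_mem_insertIdentities hD hg'
    rw [insertClass_old hlt] at e1
    rw [insertClass_old hlt'] at e2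
    rcases had_mem_insertIdentities hD h with ⟨h, ha, hb⟩ | ⟨k, ⟨rfl, rfl⟩ | ⟨rfl, hb⟩⟩
    · rw [insertClass_old ha] at e1
      rw [insertClass_old hb] at e2
      obtain ⟨e, u, v, he, -, hu, hv⟩ := hw.exists_hadEdge hD h
      rw [hu, Sum.inl.injEq] at e1
      rw [hv, Sum.inl.injEq] at e2
      exact hw.ground_indep e u v he ⟨groundSpider_of_gnd hg e1, groundSpider_of_gnd hg' e2⟩
    all_goals simp [add_assoc, insertClass_new] at e1
  · intro w α l hg hz hwl
    obtain ⟨hg, hlt⟩ := gnd_mem_insertIdentities hD hg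
    rcases Z_mem_insertIdentities hD hz with h | ⟨k, rfl | rfl⟩
    · obtain ⟨v, hv, hl⟩ := exists_vert_of_mem h
      refine hw.ground_phase v α hv (groundSpider_of_gnd hg
        (hw.zSpidersAt_eq hD (by rw [hv]; rfl) (by rwa [hl])))
    all_goals simp at hwl; omega
  · intro k w k' w' l α hk hk' hz ht ht' hwl hwl'
    by_contra hne
    rcases Z_mem_insertIdentities hD hz with h | ⟨i, hl⟩
    · have hlt := isDiagram_legs hD h
      rcases terminal_mem_insertIdentities hD ht hk with ⟨hk, hr, -⟩ | ⟨j, rfl⟩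
      · rcases terminal_mem_insertIdentities hD ht' hk' with ⟨hk', hr', -⟩ | ⟨j, rfl⟩
        · have h2 := two_le_terminalCount hk hk' ht ht' hwl hwl' hne
          have hc (x : ℕ) (hx : x ∈ l) : D.crowded x = true :=
            List.any_eq_true.2 ⟨_, h, by simp [ZXKind.isZ, hx, h2]⟩
          simp only [isReplaced, List.any_cons, List.any_nil, hc w hwl, hc w' hwl', Bool.or_false,
            Bool.and_true] at hr hr'
          simp only [ZXKind.isTerminal, hr, hr', Bool.false_or] at ht ht'
          obtain ⟨v, hv, hvl⟩ := exists_vert_of_mem h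
          obtain ⟨g, hg, hgl⟩ := exists_vert_of_mem hk
          obtain ⟨g', hg', hgl'⟩ := exists_vert_of_mem hk'
          simp only at hv hvl hg hgl hg' hgl'
          have hvz : (D.kind v).isZ := by rw [hv]; rfl
          have hne {x : D.Vert} (hx : (D.kind x).isGround) : x ≠ v := by
            rintro rfl
            simp [hv, ZXKind.isGround] at hx
          rw [← hg] at ht
          rw [← hg'] at ht'
          have := hw.one_ground v g g' hvz ht ht' ⟨w, .inl ⟨hne ht, by simp [hgl], by rwa [hvl]⟩⟩
            ⟨w', .inl ⟨hne ht', by simp [hgl'], by rwa [hvl]⟩⟩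
          subst this
          simp_all
        · have := hlt _ hwl'
          simp at this
      · have := hlt _ hwl
        simp at this
    -- A fresh spider holds wires 0 and 1, or 2 and 3, of its block, whereas a terminal on a fresh
    -- wire is always on wire 0 of a block.
    · have hge (x : ℕ) (hx : x ∈ l) : x = D.wires + 4 * i + 1 ∨ x = D.wires + 4 * i ∨
          x = D.wires + 4 * i + 2 ∨ x = D.wires + 4 * i + 3 := by
        rcases hl with rfl | rfl <;> simp at hx <;> omega
      have h0 := hge w hwl
      have h1 := hge w' hwl'
      rcases terminal_mem_insertIdentities hD ht hk with ⟨-, -, hlt⟩ | ⟨j, rfl⟩ <;>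
      rcases terminal_mem_insertIdentities hD ht' hk' with ⟨-, -, hlt'⟩ | ⟨j', rfl⟩ <;> omega

theorem WeaklyGraphLike.isDiagram_insertIdentities {n m : ℕ} (hD : D.IsDiagram n m)
    (hw : D.WeaklyGraphLike) : D.insertIdentities.IsDiagram n m := by
  have hD' := (isDiagram_iff n m D).1 hD
  have c := hw.certificate hD
  have hkind {x : ZXKind P × List ℕ} (hx : x ∈ D.insertIdentities.nodes) :
      (∃ l, (x.1, l) ∈ D.nodes) ∨ x.1 = .had ∨ x.1 = .Z 0 := by
    rcases mem_insertIdentities hD hx with ⟨h, -⟩ | ⟨v, w', k, hv, hb, hw, hx, hle⟩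
    · exact .inl ⟨x.2, h⟩
    · simp only [identityNodes, List.mem_cons, List.not_mem_nil, or_false] at hx
      rcases hx with rfl | rfl | rfl | rfl | rfl
      · exact .inl ⟨_, hv⟩
      all_goals simp
  refine (isDiagram_iff n m _).2 ⟨c.legs_lt, fun w hw => .inl ?_, c.had_deg, c.terminal_deg,
    fun x hx i hi => ?_, fun i hi => ?_, fun x hx i hi => ?_, fun i hi => ?_⟩
  · rw [count_flatMap_legs, c.z_ends w hw, c.other_ends w hw]
  · rcases hkind hx with ⟨l, h⟩ | h | h
    · exact hD'.2.2.2.2.1 _ h i hi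
    all_goals simp [h] at hi
  · rw [insertIdentities, countP_foldl_insertStep D (p := ZXKind.isInp i) rfl rfl]
    simpa using hD'.2.2.2.2.2.1 i hi
  · rcases hkind hx with ⟨l, h⟩ | h | h
    · exact hD'.2.2.2.2.2.2.1 _ h i hi
    all_goals simp [h] at hi
  · rw [insertIdentities, countP_foldl_insertStep D (p := ZXKind.isOut i) rfl rfl]
    simpa using hD'.2.2.2.2.2.2.2 i hi

end Insert

end ZXDiagram

/-! ### Tensors and their contraction -/

open ComplexConjugate

/-- A value of a wire: a row bit and a column bit. -/
abbrev DBit : Type := Fin 2 × Fin 2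

namespace DBit

/-- The identity tensor. -/
noncomputable def delta (p q : DBit) : ℂ := if p = q then 1 else 0

/-- The tensor of a Hadamard box. -/
noncomputable def had (p q : DBit) : ℂ := ZXDiagram.hEntry p.1 q.1 * conj (ZXDiagram.hEntry p.2 q.2)

/-- The weight of a spider of phase `α`. -/
noncomputable def weight (α : Real.Angle) (p : DBit) : ℂ :=
  (if p.1 = 0 then 1 else (α.toCircle : ℂ)) * conj (if p.2 = 0 then 1 else (α.toCircle : ℂ))

lemma weight_zero (p : DBit) : weight 0 p = 1 := by
  simp [weight]

lemma sum_delta_mul (p : DBit) (f : DBit → ℂ) : ∑ q, delta p q * f q = f p := by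
  simp [delta]

lemma sum_mul_delta (p : DBit) (f : DBit → ℂ) : ∑ q, f q * delta q p = f p := by
  simp [delta]

lemma delta_comm (p q : DBit) : delta p q = delta q p := by
  simp only [delta, eq_comm]

lemma inv_sqrt_two_sq : (((Real.sqrt 2 : ℝ) : ℂ)⁻¹) * (((Real.sqrt 2 : ℝ) : ℂ)⁻¹) = 1 / 2 := by
  rw [← mul_inv, ← Complex.ofReal_mul, Real.mul_self_sqrt (by norm_num)]
  norm_num

lemma sum_hEntry_mul (a b : Fin 2) :
    ∑ c, ZXDiagram.hEntry a c * ZXDiagram.hEntry c b = if a = b then 1 else 0 := by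
  have h := inv_sqrt_two_sq
  fin_cases a <;> fin_cases b <;> simp [ZXDiagram.hEntry, Fin.sum_univ_two] <;>
    linear_combination 2 * h

lemma conj_hEntry (a b : Fin 2) : conj (ZXDiagram.hEntry a b) = ZXDiagram.hEntry a b := by
  simp [ZXDiagram.hEntry]

lemma sum_had_mul_had (p r : DBit) : ∑ q, had p q * had q r = delta p r := by
  simp only [had, conj_hEntry, Fintype.sum_prod_type]
  have (c d : Fin 2) : ZXDiagram.hEntry p.1 c * ZXDiagram.hEntry p.2 d *
      (ZXDiagram.hEntry c r.1 * ZXDiagram.hEntry d r.2) =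
      (ZXDiagram.hEntry p.1 c * ZXDiagram.hEntry c r.1) *
      (ZXDiagram.hEntry p.2 d * ZXDiagram.hEntry d r.2) := by ring
  simp only [this]
  rw [← Fintype.sum_mul_sum, sum_hEntry_mul, sum_hEntry_mul, delta]
  simp only [Prod.ext_iff, ite_and]
  split_ifs <;> simp

/-- This is the value of an isolated Hadamard edge between two phase-0 spiders, the spare component
beside a row that realises the identity. -/
lemma sum_sum_had : ∑ p, ∑ q, had p q = 2 := by
  have h := inv_sqrt_two_sq
  simp [had, Fintype.sum_prod_type, Fin.sum_univ_two, ZXDiagram.hEntry]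
  linear_combination 4 * h

end DBit

namespace ZXDiagram

open DBit

/-! ### Node tensors as sums over one doubled index -/

section Tensor

variable {n m : ℕ} (x x' : Fin n → Fin 2) (y y' : Fin m → Fin 2)

lemma prod_map_mul_conj (g : Fin 2 → Fin 2 → ℂ) (a b : Fin 2) (l : List DBit) :
    ((l.map Prod.fst).map (g a)).prod * conj ((l.map Prod.snd).map (g b)).prod =
      (l.map fun q => g a q.1 * conj (g b q.2)).prod := by
  induction l with
  | nil => simp
  | cons q l ih => simp only [List.map_cons, List.prod_cons, map_mul, ← ih]; ring

/-- The product of a two-term sum with a conjugate two-term sum has four terms, one for each pair of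
a row bit and a column bit. The same identity serves both colours: `g` is the identity matrix for
Z-spiders and the Hadamard matrix for X-spiders. -/
lemma spider_mul_conj (e : ℂ) (g : Fin 2 → Fin 2 → ℂ) (l : List DBit) :
    (((l.map Prod.fst).map (g 0)).prod + e * ((l.map Prod.fst).map (g 1)).prod) *
      conj (((l.map Prod.snd).map (g 0)).prod + e * ((l.map Prod.snd).map (g 1)).prod) =
    ∑ p : DBit, ((if p.1 = 0 then 1 else e) * conj (if p.2 = 0 then 1 else e)) *
      (l.map fun q => g p.1 q.1 * conj (g p.2 q.2)).prod := by
  simp only [Fintype.sum_prod_type, Fin.sum_univ_two, ← prod_map_mul_conj, map_add, map_mul]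
  simp
  ring

lemma prod_map_delta (a : Fin 2) (l : List (Fin 2)) :
    (l.map fun b => if a = b then (1 : ℂ) else 0).prod = if ∀ b ∈ l, b = a then 1 else 0 := by
  induction l with
  | nil => simp
  | cons b l ih =>
    rw [List.map_cons, List.prod_cons, ih]
    simp only [List.forall_mem_cons, ite_and, eq_comm (a := a)]
    split_ifs <;> simp

lemma nodeTensor_Z (α : Real.Angle) (l : List DBit) :
    nodeTensor x x' y y' (.Z α) l = ∑ p, weight α p * (l.map (delta p)).prod := by
  have h := spider_mul_conj (α.toCircle : ℂ) (fun a b => if a = b then 1 else 0) l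
  have hz (l : List (Fin 2)) : zTensor α l = (l.map fun b => if 0 = b then (1 : ℂ) else 0).prod +
      (α.toCircle : ℂ) * (l.map fun b => if 1 = b then (1 : ℂ) else 0).prod := by
    simp [zTensor, prod_map_delta]
  rw [nodeTensor, hz, hz, h]
  refine Finset.sum_congr rfl fun p _ => ?_
  rw [weight]
  congr 2
  refine List.map_congr_left fun q _ => ?_
  simp only [delta, Prod.ext_iff, ite_and]
  split_ifs <;> simp

lemma nodeTensor_X (α : Real.Angle) (l : List DBit) :
    nodeTensor x x' y y' (.X α) l = ∑ p, weight α p * (l.map (had p)).prod := by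
  rw [nodeTensor, xTensor, xTensor, spider_mul_conj]
  rfl

lemma nodeTensor_had (p q : DBit) : nodeTensor x x' y y' .had [p, q] = had p q := rfl

lemma nodeTensor_Z_pair (p q : DBit) : nodeTensor x x' y y' (.Z 0) [p, q] = delta p q := by
  simp only [nodeTensor_Z, weight_zero, List.map_cons, List.map_nil, List.prod_cons, List.prod_nil,
    mul_one, one_mul, delta_comm _ p]
  exact sum_delta_mul p _

lemma nodeTensor_Z_single (p : DBit) : nodeTensor x x' y y' (.Z 0) [p] = 1 := by
  simp only [nodeTensor_Z, weight_zero, List.map_cons, List.map_nil, List.prod_cons, List.prod_nil,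
    mul_one, one_mul]
  simpa using sum_mul_delta p fun _ => 1

end Tensor

/-! ### Summation over the values of the wires -/

section Contraction

/-- The values of the wires as a function on all natural numbers. -/
def extend {n : ℕ} (s : Fin n → DBit) (w : ℕ) : DBit := if h : w < n then s ⟨w, h⟩ else (0, 0)

/-- Integrands are functions of values on all of `ℕ`, so diagrams with different numbers of wires
can share one. Here the last `b` wires are split off and can be summed on their own. -/
lemma sum_fin_add (a b : ℕ) (F : (ℕ → DBit) → ℂ) :
    ∑ s : Fin (a + b) → DBit, F (extend s) = ∑ s : Fin a → DBit, ∑ t : Fin b → DBit,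
      F fun w => if w < a then extend s w else extend t (w - a) := by
  rw [← (Fin.appendEquiv a b).sum_comp, Fintype.sum_prod_type]
  refine Finset.sum_congr rfl fun s _ => Finset.sum_congr rfl fun t _ => congrArg F ?_
  ext1 w
  simp only [extend, Fin.appendEquiv, Equiv.coe_fn_mk]
  by_cases h : w < a
  · rw [dif_pos (by omega), if_pos h, dif_pos h]
    exact Fin.append_left s t ⟨w, h⟩
  · rw [if_neg h]
    by_cases h' : w < a + b
    · rw [dif_pos h', dif_pos (by omega)]
      convert Fin.append_right s t ⟨w - a, by omega⟩ using 2
      ext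
      simp
      omega
    · rw [dif_neg h', dif_neg (by omega)]

lemma sum_fin_succ (n : ℕ) (F : (Fin (n + 1) → DBit) → ℂ) :
    ∑ s, F s = ∑ q, ∑ s : Fin n → DBit, F (Fin.cons q s) := by
  rw [← (Fin.consEquiv fun _ => DBit).sum_comp, Fintype.sum_prod_type]
  rfl

lemma sum_fin_zero (F : (Fin 0 → DBit) → ℂ) : ∑ s, F s = F Fin.elim0 := by
  rw [Fintype.sum_unique]
  congr 1

variable {n m : ℕ} (x x' : Fin n → Fin 2) (y y' : Fin m → Fin 2)

/-- The product of the tensors of the nodes in `N`, at the values `σ` of the wires. -/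
noncomputable def tensorProd (N : List (ZXKind Real.Angle × List ℕ)) (σ : ℕ → DBit) : ℂ :=
  (N.map fun v => nodeTensor x x' y y' v.1 (v.2.map σ)).prod

lemma kernel_eq (D : ZXDiagram Real.Angle) :
    D.kernel x x' y y' = ∑ s : Fin D.wires → DBit, tensorProd x x' y y' D.nodes (extend s) := rfl

lemma tensorProd_append (N M : List (ZXKind Real.Angle × List ℕ)) (σ : ℕ → DBit) :
    tensorProd x x' y y' (N ++ M) σ = tensorProd x x' y y' N σ * tensorProd x x' y y' M σ := by
  simp [tensorProd]

lemma tensorProd_congr {N : List (ZXKind Real.Angle × List ℕ)} {σ τ : ℕ → DBit}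
    (h : ∀ v ∈ N, ∀ w ∈ v.2, σ w = τ w) :
    tensorProd x x' y y' N σ = tensorProd x x' y y' N τ := by
  refine congrArg List.prod (List.map_congr_left fun v hv => ?_)
  rw [List.map_congr_left (h v hv)]

theorem equivalent_of_kernel {D D' : ZXDiagram Real.Angle} (c : ℝ) (hc : 0 < c)
    (h : ∀ x x' : Fin n → Fin 2, ∀ y y' : Fin m → Fin 2,
      D.kernel x x' y y' = c * D'.kernel x x' y y') : Equivalent n m D D' := by
  refine ⟨c, hc, fun ρ => ?_⟩
  ext y y'
  simp only [interp, Matrix.of_apply, Matrix.smul_apply, smul_eq_mul, Finset.mul_sum, h, mul_assoc]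

/-- The sums are done from the innermost fresh wire outwards: the phase-0 spiders are identity
tensors, the two Hadamard tensors compose to the identity, and `v` is left reading the old wire. -/
lemma sum_identityNodes (v : ZXKind Real.Angle) (b w : ℕ) (hw : w < b) (s : ℕ → DBit) :
    ∑ t : Fin 4 → DBit, tensorProd x x' y y' (identityNodes b (v, [w]))
      (fun w => if w < b then s w else extend t (w - b)) =
    nodeTensor x x' y y' v [s w] := by
  have h (t : Fin 4 → DBit) : tensorProd x x' y y' (identityNodes b (v, [w]))
      (fun w => if w < b then s w else extend t (w - b)) =
      nodeTensor x x' y y' v [t 0] * (delta (t 0) (t 1) * (had (t 1) (t 2) *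
        (delta (t 2) (t 3) * had (t 3) (s w)))) := by
    simp [tensorProd, identityNodes, nodeTensor_Z_pair, nodeTensor_had, extend, hw]
  simp only [h, sum_fin_succ, sum_fin_zero]
  simp only [show (1 : Fin 4) = Fin.succ 0 from rfl,
    show (2 : Fin 4) = Fin.succ (Fin.succ 0) from rfl,
    show (3 : Fin 4) = Fin.succ (Fin.succ (Fin.succ 0)) from rfl, Fin.cons_zero, Fin.cons_succ,
    ← Finset.mul_sum, sum_delta_mul, sum_had_mul_had, sum_mul_delta]

/-- The invariant is that the nodes built so far, followed by those still to be treated, have the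
same contraction. Old nodes do not read the four new wires, so these can be summed out of the
inserted block alone. -/
lemma sum_foldl_insertStep {D : ZXDiagram Real.Angle} (N : List (ZXKind Real.Angle × List ℕ))
    (hN : ∀ v ∈ N, (∀ w ∈ v.2, w < D.wires) ∧ (v.1.isBoundary → v.2.length = 1))
    (E : ZXDiagram Real.Angle) (hE : D.wires ≤ E.wires)
    (hlt : ∀ v ∈ E.nodes, ∀ w ∈ v.2, w < E.wires) :
    (N.foldl (insertStep D) E).kernel x x' y y' =
      ∑ s : Fin E.wires → DBit, tensorProd x x' y y' (E.nodes ++ N) (extend s) := by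
  induction N generalizing E with
  | nil => simp [kernel_eq]
  | cons v N ih =>
    have hv := hN v (by simp)
    have hN' := fun u hu => hN u (List.mem_cons_of_mem v hu)
    rw [List.foldl_cons, insertStep_eq]
    split_ifs with hr
    · have hb : v.1.isBoundary := (Bool.and_eq_true_iff.1 hr).1
      obtain ⟨k, l⟩ := v
      obtain ⟨w, rfl⟩ : ∃ w, l = [w] := List.length_eq_one_iff.1 (hv.2 hb)
      have hw : w < E.wires := (hv.1 w (by simp)).trans_le hE
      rw [ih hN' _ (by simp only; omega)]
      · simp only
        rw [sum_fin_add E.wires 4 (fun σ => tensorProd x x' y y'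
          (E.nodes ++ identityNodes E.wires (k, [w]) ++ N) σ)]
        refine Finset.sum_congr rfl fun s _ => ?_
        have h1 (t : Fin 4 → DBit) : tensorProd x x' y y' E.nodes
            (fun w => if w < E.wires then extend s w else extend t (w - E.wires)) =
            tensorProd x x' y y' E.nodes (extend s) :=
          tensorProd_congr _ _ _ _ fun v hv w hw => if_pos (hlt v hv w hw)
        have h2 (t : Fin 4 → DBit) : tensorProd x x' y y' N
            (fun w => if w < E.wires then extend s w else extend t (w - E.wires)) =
            tensorProd x x' y y' N (extend s) :=
          tensorProd_congr _ _ _ _ fun v hv w hw => if_pos (((hN' v hv).1 w hw).trans_le hE)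
        simp only [tensorProd_append, h1, h2]
        rw [← Finset.sum_mul, ← Finset.mul_sum, sum_identityNodes _ _ _ _ k _ w hw]
        simp [tensorProd, mul_assoc]
      · intro u hu w' hw'
        simp only [List.mem_append] at hu
        rcases hu with hu | hu
        · exact (hlt u hu w' hw').trans_le (by simp)
        · simp only [identityNodes, List.mem_cons, List.not_mem_nil, or_false] at hu
          rcases hu with rfl | rfl | rfl | rfl | rfl <;> simp at hw' ⊢ <;> omega
    · rw [ih hN' ⟨E.wires, E.nodes ++ [v]⟩ hE]
      · simp
      · intro u hu w' hw'
        simp only [List.mem_append, List.mem_singleton] at hu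
        rcases hu with hu | rfl
        · exact hlt u hu w' hw'
        · exact (hv.1 w' hw').trans_le hE

theorem IsDiagram.equivalent_insertIdentities {D : ZXDiagram Real.Angle} (hD : D.IsDiagram n m) :
    Equivalent n m D D.insertIdentities := by
  have hD' := (isDiagram_iff n m D).1 hD
  refine equivalent_of_kernel 1 one_pos fun x x' y y' => ?_
  rw [insertIdentities, sum_foldl_insertStep x x' y y' (D := D) D.nodes _ ⟨D.wires, []⟩ le_rfl (by simp)]
  · simp [kernel_eq]
  · exact fun v hv => ⟨hD'.1 v hv, fun hb => hD'.2.2.2.1 v hv (by simp [ZXKind.isTerminal, hb])⟩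

end Contraction

end ZXDiagram

/-! ### Diagrams assembled from a table of legs -/

namespace ZXKind

variable {P : Type}

def isX : ZXKind P → Bool
  | X _ => true
  | _ => false

/-- The phase of a spider, and `0` for the other nodes. -/
def corePhase [Zero P] : ZXKind P → P
  | Z α => α
  | X α => α
  | _ => 0

end ZXKind

namespace ZXDiagram

variable {P : Type}

/-- An entry of a table of legs: the index of a node, a wire, and whether a Hadamard gate stands
between them. -/
abbrev Leg : Type := ℕ × ℕ × Bool

def legAt (Λ : List Leg) (e : ℕ) : Leg := Λ.getD e (0, 0, false)

def kindAt (K : List (ZXKind P)) (i : ℕ) : ZXKind P := K.getD i .gnd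

/-- The nodes of the `e`-th leg, with wires `6e, …, 6e + 5`.  The wires `6e` and `6e + 5` are joined
by three Hadamard edges in a row if `b` holds; otherwise by two, and the third one is isolated. -/
def chainNodes [Zero P] (e : ℕ) (b : Bool) : List (ZXKind P × List ℕ) :=
  [(.had, [6 * e, 6 * e + 1]), (.had, [6 * e + 2, 6 * e + 3]), (.had, [6 * e + 4, 6 * e + 5])] ++
  bif b then [(.Z 0, [6 * e + 1, 6 * e + 2]), (.Z 0, [6 * e + 3, 6 * e + 4])]
    else [(.Z 0, [6 * e + 1, 6 * e + 4]), (.Z 0, [6 * e + 2]), (.Z 0, [6 * e + 3])]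

def portNode (K : List (ZXKind P)) (L j : ℕ) : ZXKind P × List ℕ := (kindAt K j, [6 * L + j])

/-- The Z-spider for the `i`-th node. -/
def coreNode [Zero P] (K : List (ZXKind P)) (T : ℕ) (Λ : List Leg) (i : ℕ) : ZXKind P × List ℕ :=
  (.Z (kindAt K i).corePhase, (if i < T then [6 * Λ.length + i] else []) ++
    ((List.range Λ.length).filter fun e => (legAt Λ e).1 = i).map fun e => 6 * e)

/-- The Z-spider for the wire `w`. -/
def wireNode [Zero P] (Λ : List Leg) (w : ℕ) : ZXKind P × List ℕ :=
  (.Z 0, ((List.range Λ.length).filter fun e => (legAt Λ e).2.1 = w).map fun e => 6 * e + 5)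

/-- The diagram with a Z-spider for each node of kind in `K`, the first `T` of which are attached to
an input, output or ground, a Z-spider for each of the wires `0, …, W - 1`, and a row of Hadamard
edges for each leg in `Λ`. -/
def assemble [Zero P] (K : List (ZXKind P)) (T W : ℕ) (Λ : List Leg) : ZXDiagram P :=
  ⟨6 * Λ.length + T,
    (List.range T).map (portNode K Λ.length) ++ (List.range K.length).map (coreNode K T Λ) ++
    (List.range W).map (wireNode Λ) ++
    (List.range Λ.length).flatMap fun e => chainNodes e (legAt Λ e).2.2⟩

/-! ### Wire ends, certificate and well-formedness of assembled diagrams -/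

section Assemble

variable [Zero P] {K : List (ZXKind P)} {T W : ℕ} {Λ : List Leg}

lemma mem_assemble {x : ZXKind P × List ℕ} (hx : x ∈ (assemble K T W Λ).nodes) :
    (∃ j < T, x = portNode K Λ.length j) ∨ (∃ i, x = coreNode K T Λ i) ∨
      (∃ w, x = wireNode Λ w) ∨ ∃ e < Λ.length, x ∈ chainNodes e (legAt Λ e).2.2 := by
  simp only [assemble, List.mem_append, List.mem_map, List.mem_range, List.mem_flatMap] at hx
  rcases hx with ((⟨j, hj, rfl⟩ | ⟨i, -, rfl⟩) | ⟨w, -, rfl⟩) | ⟨e, he, hx⟩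
  · exact .inl ⟨j, hj, rfl⟩
  · exact .inr (.inl ⟨i, rfl⟩)
  · exact .inr (.inr (.inl ⟨w, rfl⟩))
  · exact .inr (.inr (.inr ⟨e, he, hx⟩))

omit [Zero P] in
lemma endCount_map_range (p : ZXKind P → Bool) (n : ℕ) (f : ℕ → ZXKind P × List ℕ) (w : ℕ) :
    endCount p ((List.range n).map f) w =
      ∑ i ∈ Finset.range n, if p (f i).1 then (f i).2.count w else 0 := by
  rw [endCount, List.map_map, Finset.sum_range, ← List.sum_ofFn, List.ofFn_eq_map,
    ← List.map_coe_finRange_eq_range, List.map_map]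
  rfl

omit [Zero P] in
lemma endCount_flatMap_range (p : ZXKind P → Bool) (n : ℕ) (f : ℕ → List (ZXKind P × List ℕ))
    (w : ℕ) : endCount p ((List.range n).flatMap f) w =
      ∑ i ∈ Finset.range n, endCount p (f i) w := by
  induction n with
  | zero => simp
  | succ n ih => rw [List.range_succ, List.flatMap_append, endCount_append, ih,
      Finset.sum_range_succ]; simp

lemma count_map_filter_range (n : ℕ) (q : ℕ → Prop) [DecidablePred q] (f : ℕ → ℕ) (w : ℕ) :
    (((List.range n).filter fun e => q e).map f).count w =
      ∑ e ∈ Finset.range n, if q e then (if f e = w then 1 else 0) else 0 := by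
  induction n with
  | zero => simp
  | succ n ih =>
    rw [List.range_succ, List.filter_append, List.map_append, List.count_append, ih,
      Finset.sum_range_succ]
    by_cases h : q n <;> simp [h, List.count_cons]

lemma sum_sum_ite_eq (n k : ℕ) (o g : ℕ → ℕ) (ho : ∀ e < n, o e < k) :
    ∑ i ∈ Finset.range k, ∑ e ∈ Finset.range n, (if o e = i then g e else 0) =
      ∑ e ∈ Finset.range n, g e := by
  rw [Finset.sum_comm]
  refine Finset.sum_congr rfl fun e he => ?_
  rw [Finset.sum_ite_eq, if_pos (Finset.mem_range.2 (ho e (Finset.mem_range.1 he)))]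

lemma sum_ite_div_six (n w : ℕ) :
    (∑ e ∈ Finset.range n, if w / 6 = e then 1 else 0) = if w < 6 * n then 1 else 0 := by
  rw [Finset.sum_ite_eq]
  simp only [Finset.mem_range]
  split_ifs <;> omega

lemma sum_ite_add_eq (n a w : ℕ) :
    (∑ j ∈ Finset.range n, if a + j = w then 1 else 0) = if a ≤ w ∧ w < a + n then 1 else 0 := by
  induction n with
  | zero => simp
  | succ n ih => rw [Finset.sum_range_succ, ih]; split_ifs <;> omega

/-- In the row of leg `e`, wire `6e` ends at a core, wire `6e + 5` at a wire-spider, and the four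
between at spiders of the row; every port ends at its own core. -/
lemma endCount_isZ_assemble (hT : ∀ j < T, (kindAt K j).isTerminal) (hTK : T ≤ K.length)
    (ho : ∀ e < Λ.length, (legAt Λ e).1 < K.length) (hW : ∀ e < Λ.length, (legAt Λ e).2.1 < W)
    (w : ℕ) (hw : w < (assemble K T W Λ).wires) :
    endCount ZXKind.isZ (assemble K T W Λ).nodes w = 1 := by
  have hports : endCount ZXKind.isZ ((List.range T).map (portNode K Λ.length)) w = 0 := by
    rw [endCount_map_range, Finset.sum_eq_zero]
    intro j hj
    simp [portNode, ZXKind.not_isZ_of_isTerminal (hT j (Finset.mem_range.1 hj))]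
  have hcores : endCount ZXKind.isZ ((List.range K.length).map (coreNode K T Λ)) w =
      (∑ j ∈ Finset.range T, if 6 * Λ.length + j = w then 1 else 0) +
        ∑ e ∈ Finset.range Λ.length, if 6 * e = w then 1 else 0 := by
    rw [endCount_map_range]
    simp only [coreNode, ZXKind.isZ, if_true, List.count_append, count_map_filter_range,
      Finset.sum_add_distrib]
    rw [sum_sum_ite_eq _ _ _ _ ho]
    congr 1
    rw [← Finset.sum_subset (Finset.range_subset_range.2 hTK)]
    · refine Finset.sum_congr rfl fun j hj => ?_
      simp [Finset.mem_range.1 hj, List.count_cons]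
    · intro i _ hi
      rw [Finset.mem_range] at hi
      simp [hi]
  have hwires : endCount ZXKind.isZ ((List.range W).map (wireNode (P := P) Λ)) w =
      ∑ e ∈ Finset.range Λ.length, if 6 * e + 5 = w then 1 else 0 := by
    rw [endCount_map_range]
    simp only [wireNode, ZXKind.isZ, if_true, count_map_filter_range]
    rw [sum_sum_ite_eq _ _ _ _ hW]
  -- The two outer wires are added to the count because their Z-ends lie outside the row. The total
  -- is one end for each wire whose number has quotient `e` by 6.
  have hchain (e : ℕ) (b : Bool) : endCount ZXKind.isZ (chainNodes (P := P) e b) w +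
      ((if 6 * e = w then 1 else 0) + (if 6 * e + 5 = w then 1 else 0)) =
      if w / 6 = e then 1 else 0 := by
    cases b <;> simp [chainNodes, ZXKind.isZ, List.count_cons] <;> split_ifs <;> omega
  change endCount _ (_ ++ _ ++ _ ++ _) w = 1
  rw [endCount_append, endCount_append, endCount_append, hports, hcores, hwires,
    endCount_flatMap_range]
  have hsum := Finset.sum_congr rfl fun e (_ : e ∈ Finset.range Λ.length) =>
    hchain e (legAt Λ e).2.2
  rw [Finset.sum_add_distrib, Finset.sum_add_distrib, sum_ite_div_six] at hsum
  rw [sum_ite_add_eq]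
  simp only [assemble] at hw
  split_ifs at hsum ⊢ <;> omega

lemma endCount_not_isZ_assemble (hT : ∀ j < T, (kindAt K j).isTerminal)
    (w : ℕ) (hw : w < (assemble K T W Λ).wires) :
    endCount (fun k => !k.isZ) (assemble K T W Λ).nodes w = 1 := by
  have hports : endCount (fun k => !k.isZ) ((List.range T).map (portNode K Λ.length)) w =
      ∑ j ∈ Finset.range T, if 6 * Λ.length + j = w then 1 else 0 := by
    rw [endCount_map_range]
    refine Finset.sum_congr rfl fun j hj => ?_
    simp [portNode, ZXKind.not_isZ_of_isTerminal (hT j (Finset.mem_range.1 hj)), List.count_cons]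
  have hchain (e : ℕ) (b : Bool) : endCount (fun k => !k.isZ) (chainNodes (P := P) e b) w =
      if w / 6 = e then 1 else 0 := by
    cases b <;> simp [chainNodes, ZXKind.isZ, List.count_cons] <;> split_ifs <;> omega
  change endCount _ (_ ++ _ ++ _ ++ _) w = 1
  rw [endCount_append, endCount_append, endCount_append, hports, endCount_flatMap_range,
    endCount_map_range, endCount_map_range]
  simp only [hchain, sum_ite_div_six]
  simp only [assemble] at hw
  simp only [sum_ite_add_eq, coreNode, wireNode, ZXKind.isZ, Bool.not_true, Bool.false_eq_true,
    if_false, Finset.sum_const_zero]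
  split_ifs <;> omega

/-- The classes of the wires of an assembled diagram. -/
def assembleClass (Λ : List Leg) (w : ℕ) : ℕ × ℕ :=
  if 6 * Λ.length ≤ w ∨ w % 6 = 0 then (0, 0) else if w % 6 = 5 then (0, 1) else
    (w / 6 + 1, if (legAt Λ (w / 6)).2.2 then (w % 6 - 1) / 2 else
      if w % 6 = 2 ∨ w % 6 = 3 then w % 6 else 0)

lemma assembleClass_port (j : ℕ) : assembleClass Λ (6 * Λ.length + j) = (0, 0) :=
  if_pos (.inl (by omega))

lemma assembleClass_leg {e i : ℕ} (he : e < Λ.length) (hi : i < 6) :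
    assembleClass Λ (6 * e + i) = if i = 0 then (0, 0) else if i = 5 then (0, 1) else
      (e + 1, if (legAt Λ e).2.2 then (i - 1) / 2 else if i = 2 ∨ i = 3 then i else 0) := by
  rw [assembleClass, show (6 * e + i) % 6 = i by omega, show (6 * e + i) / 6 = e by omega]
  simp only [show ¬ 6 * Λ.length ≤ 6 * e + i by omega, false_or]

lemma had_mem_assemble (hT : ∀ j < T, (kindAt K j).isTerminal) {l : List ℕ}
    (h : (.had, l) ∈ (assemble K T W Λ).nodes) :
    ∃ e < Λ.length, ∃ i < 3, l = [6 * e + 2 * i, 6 * e + (2 * i + 1)] := by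
  rcases mem_assemble h with ⟨j, hj, hx⟩ | ⟨i, hx⟩ | ⟨w, hx⟩ | ⟨e, he, hx⟩
  · have := hT j hj
    rw [← show _ = kindAt K j from congrArg Prod.fst hx] at this
    simp [ZXKind.isTerminal, ZXKind.isBoundary, ZXKind.isGround] at this
  · simp [coreNode] at hx
  · simp [wireNode] at hx
  · refine ⟨e, he, ?_⟩
    have : l = [6 * e, 6 * e + 1] ∨ l = [6 * e + 2, 6 * e + 3] ∨ l = [6 * e + 4, 6 * e + 5] := by
      revert hx
      cases (legAt Λ e).2.2 <;> simp [chainNodes]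
    rcases this with rfl | rfl | rfl
    · exact ⟨0, by simp⟩
    · exact ⟨1, by simp⟩
    · exact ⟨2, by simp⟩

lemma terminal_mem_assemble {k : ZXKind P} (hk : k.isTerminal) {l : List ℕ}
    (h : (k, l) ∈ (assemble K T W Λ).nodes) :
    ∃ j < T, k = kindAt K j ∧ l = [6 * Λ.length + j] := by
  rcases mem_assemble h with ⟨j, hj, hx⟩ | ⟨i, hx⟩ | ⟨w, hx⟩ | ⟨e, he, hx⟩
  · exact ⟨j, hj, Prod.ext_iff.1 hx⟩
  · rw [show k = _ from congrArg Prod.fst hx] at hk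
    simp [coreNode, ZXKind.isTerminal, ZXKind.isBoundary, ZXKind.isGround] at hk
  · rw [show k = _ from congrArg Prod.fst hx] at hk
    simp [wireNode, ZXKind.isTerminal, ZXKind.isBoundary, ZXKind.isGround] at hk
  · exfalso
    revert hx
    cases (legAt Λ e).2.2 <;> intro hx <;> simp [chainNodes] at hx <;>
      rcases hx with ⟨rfl, -⟩ | ⟨rfl, -⟩ | ⟨rfl, -⟩ | ⟨rfl, -⟩ | ⟨rfl, -⟩ | ⟨rfl, -⟩ <;>
      simp [ZXKind.isTerminal, ZXKind.isBoundary, ZXKind.isGround] at hk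

lemma Z_mem_assemble (hT : ∀ j < T, (kindAt K j).isTerminal) {α : P} {l : List ℕ}
    (h : (.Z α, l) ∈ (assemble K T W Λ).nodes) :
    (∃ i, (.Z α, l) = coreNode K T Λ i) ∨ (.Z α, l) ∈ Set.range (wireNode (P := P) Λ) ∨
      ∃ e < Λ.length, (.Z α, l) ∈ chainNodes e (legAt Λ e).2.2 := by
  rcases mem_assemble h with ⟨j, hj, hx⟩ | ⟨i, hx⟩ | ⟨w, hx⟩ | ⟨e, he, hx⟩
  · have := hT j hj
    rw [← show _ = kindAt K j from congrArg Prod.fst hx] at this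
    simp [ZXKind.isTerminal, ZXKind.isBoundary, ZXKind.isGround] at this
  · exact .inl ⟨i, hx⟩
  · exact .inr (.inl ⟨w, hx.symm⟩)
  · exact .inr (.inr ⟨e, he, hx⟩)

lemma mem_coreNode {i w : ℕ} (h : w ∈ (coreNode K T Λ i).2) :
    (i < T ∧ w = 6 * Λ.length + i) ∨ ∃ e < Λ.length, w = 6 * e := by
  simp only [coreNode, List.mem_append, List.mem_map, List.mem_filter, List.mem_range] at h
  rcases h with h | ⟨e, ⟨he, -⟩, rfl⟩
  · split_ifs at h with hi
    · exact .inl ⟨hi, by simpa using h⟩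
    · simp at h
  · exact .inr ⟨e, he, rfl⟩

lemma mem_wireNode {v w : ℕ} (h : w ∈ (wireNode (P := P) Λ v).2) :
    ∃ e < Λ.length, w = 6 * e + 5 := by
  simp only [wireNode, List.mem_map, List.mem_filter, List.mem_range] at h
  obtain ⟨e, ⟨he, -⟩, rfl⟩ := h
  exact ⟨e, he, rfl⟩

lemma mem_chainNodes {e : ℕ} {b : Bool} {x : ZXKind P × List ℕ} (hx : x ∈ chainNodes e b) {w : ℕ}
    (hw : w ∈ x.2) : ∃ i < 6, w = 6 * e + i := by
  cases b <;> simp [chainNodes] at hx <;> rcases hx with rfl | rfl | rfl | rfl | rfl | rfl <;>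
    simp at hw <;> exact ⟨w - 6 * e, by omega, by omega⟩

/-- Only the core numbered `i` can hold the port numbered `i`. The other spiders hold no port, and
for them the witness 0 serves vacuously. -/
lemma port_unique (hT : ∀ j < T, (kindAt K j).isTerminal) {α : P} {l : List ℕ}
    (h : (.Z α, l) ∈ (assemble K T W Λ).nodes) :
    ∃ i, ∀ j, 6 * Λ.length + j ∈ l → j = i ∧ α = (kindAt K i).corePhase := by
  rcases Z_mem_assemble hT h with ⟨i, hx⟩ | ⟨w, hx⟩ | ⟨e, he, hx⟩
  · obtain ⟨h1, rfl⟩ := Prod.ext_iff.1 hx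
    refine ⟨i, fun j hj => ⟨?_, by simpa [coreNode] using h1⟩⟩
    rcases mem_coreNode hj with h | ⟨e, he, h⟩ <;> omega
  · obtain ⟨-, rfl⟩ := Prod.ext_iff.1 hx
    refine ⟨0, fun j hj => ?_⟩
    obtain ⟨e, he, h⟩ := mem_wireNode hj
    omega
  · refine ⟨0, fun j hj => ?_⟩
    obtain ⟨i, hi, h⟩ := mem_chainNodes hx hj
    omega

/-- All cores may share the class `(0, 0)` and all wire-spiders the class `(0, 1)`: every Hadamard
edge has an end at an inner spider of its row, and inner spiders have classes of their own. So this
coarse labelling still separates all edges. -/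
theorem certificate_assemble (hT : ∀ j < T, (kindAt K j).isTerminal) (hTK : T ≤ K.length)
    (ho : ∀ e < Λ.length, (legAt Λ e).1 < K.length) (hW : ∀ e < Λ.length, (legAt Λ e).2.1 < W) :
    (assemble K T W Λ).Certificate (assembleClass Λ) := by
  have had_ne : ∀ a b, (.had, [a, b]) ∈ (assemble K T W Λ).nodes →
      assembleClass Λ a ≠ assembleClass Λ b := by
    intro a b h
    obtain ⟨e, he, i, hi, hl⟩ := had_mem_assemble hT h
    simp only [List.cons.injEq, and_true] at hl
    obtain ⟨rfl, rfl⟩ := hl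
    rw [assembleClass_leg he (by omega), assembleClass_leg he (by omega)]
    interval_cases i <;> cases (legAt Λ e).2.2 <;> simp
  have hgnd {w : ℕ} (h : (.gnd, [w]) ∈ (assemble K T W Λ).nodes) :
      ∃ j, .gnd = kindAt K j ∧ w = 6 * Λ.length + j := by
    obtain ⟨j, -, hj, hw⟩ := terminal_mem_assemble (k := .gnd) rfl h
    exact ⟨j, hj, by simpa using hw⟩
  refine
    { legs_lt := ?_
      z_ends := endCount_isZ_assemble hT hTK ho hW
      other_ends := endCount_not_isZ_assemble hT
      had_deg := ?_
      terminal_deg := ?_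
      no_X := ?_
      cls_eq := ?_
      had_ne := had_ne
      had_pair := ?_
      ground := ?_
      phase := ?_
      one := ?_ }
  · intro x hx w hw
    change w < 6 * Λ.length + T
    rcases mem_assemble hx with ⟨j, hj, rfl⟩ | ⟨i, rfl⟩ | ⟨v, rfl⟩ | ⟨e, he, hx⟩
    · simp [portNode] at hw
      omega
    · rcases mem_coreNode hw with ⟨h, rfl⟩ | ⟨e, he, rfl⟩ <;> omega
    · obtain ⟨e, he, rfl⟩ := mem_wireNode hw
      omega
    · obtain ⟨i, hi, rfl⟩ := mem_chainNodes hx hw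
      omega
  · rintro ⟨k, l⟩ hx rfl
    obtain ⟨e, -, i, -, rfl⟩ := had_mem_assemble hT hx
    rfl
  · rintro ⟨k, l⟩ hx hk
    obtain ⟨j, -, -, rfl⟩ := terminal_mem_assemble hk hx
    rfl
  · rintro ⟨k, l⟩ hx α rfl
    rcases mem_assemble hx with ⟨j, hj, h⟩ | ⟨i, h⟩ | ⟨v, h⟩ | ⟨e, he, h⟩
    · have := hT j hj
      rw [← show _ = kindAt K j from congrArg Prod.fst h] at this
      simp [ZXKind.isTerminal, ZXKind.isBoundary, ZXKind.isGround] at this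
    · simp [coreNode] at h
    · simp [wireNode] at h
    · revert h
      cases (legAt Λ e).2.2 <;> simp [chainNodes]
  · rintro ⟨k, l⟩ hx hz a ha b hb
    obtain ⟨α, rfl⟩ := ZXKind.isZ_iff.1 hz
    simp only at ha hb
    rcases Z_mem_assemble hT hx with ⟨i, h⟩ | ⟨w, h⟩ | ⟨e, he, h⟩
    · have hcls {c : ℕ} (hc : c ∈ l) : assembleClass Λ c = (0, 0) := by
        rw [show l = _ from congrArg Prod.snd h] at hc
        rcases mem_coreNode hc with ⟨-, rfl⟩ | ⟨e, he, rfl⟩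
        · exact assembleClass_port i
        · exact assembleClass_leg (i := 0) he (by norm_num)
      rw [hcls ha, hcls hb]
    · have hcls {c : ℕ} (hc : c ∈ l) : assembleClass Λ c = (0, 1) := by
        rw [← show _ = l from congrArg Prod.snd h] at hc
        obtain ⟨e, he, rfl⟩ := mem_wireNode hc
        exact assembleClass_leg (i := 5) he (by norm_num)
      rw [hcls ha, hcls hb]
    · have hleg {i : ℕ} := assembleClass_leg (i := i) he
      revert h
      cases hbit : (legAt Λ e).2.2 <;> simp only [hbit] at hleg <;> intro h <;>
        simp [chainNodes] at h
      · rcases h with ⟨-, rfl⟩ | ⟨-, rfl⟩ | ⟨-, rfl⟩ <;> simp at ha hb <;>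
        rcases ha with rfl | rfl <;> rcases hb with rfl | rfl <;> simp [hleg]
      · rcases h with ⟨-, rfl⟩ | ⟨-, rfl⟩ <;> simp at ha hb <;>
        rcases ha with rfl | rfl <;> rcases hb with rfl | rfl <;> simp [hleg]
  · intro a b a' b' h h'
    obtain ⟨e, he, i, hi, hl⟩ := had_mem_assemble hT h
    obtain ⟨e', he', i', hi', hl'⟩ := had_mem_assemble hT h'
    simp only [List.cons.injEq, and_true] at hl hl'
    obtain ⟨rfl, rfl⟩ := hl
    obtain ⟨rfl, rfl⟩ := hl'
    rw [assembleClass_leg he (by omega), assembleClass_leg he (by omega),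
      assembleClass_leg he' (by omega), assembleClass_leg he' (by omega)]
    intro hc
    -- The inner end of an edge has first coordinate `e + 1`, which identifies the row; the three
    -- edges of one row have different pairs of classes.
    have key : e = e' ∧ i = i' := by
      have hee : e = e' := by
        revert hc
        interval_cases i <;> interval_cases i' <;> simp <;> omega
      subst hee
      refine ⟨rfl, ?_⟩
      revert hc
      interval_cases i <;> interval_cases i' <;> cases (legAt Λ e).2.2 <;> simp
    obtain ⟨rfl, rfl⟩ := key
    exact ⟨6 * e + 2 * i, by simp, by simp⟩
  · rintro a b w w' h hg hg' ⟨e1, e2⟩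
    obtain ⟨j, -, rfl⟩ := hgnd hg
    obtain ⟨j', -, rfl⟩ := hgnd hg'
    rw [assembleClass_port] at e1 e2
    -- Both grounds are on ports, hence in the common class of the cores, while an edge joins
    -- different classes.
    exact had_ne a b h (e1.symm.trans e2)
  · intro w α l hg hz hw
    obtain ⟨j, hj, rfl⟩ := hgnd hg
    obtain ⟨i, hi⟩ := port_unique hT hz
    obtain ⟨rfl, rfl⟩ := hi j hw
    rw [← hj]
    rfl
  · intro k w k' w' l α hk hk' hz ht ht' hw hw'
    obtain ⟨j, -, -, h⟩ := terminal_mem_assemble ht hk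
    obtain ⟨j', -, -, h'⟩ := terminal_mem_assemble ht' hk'
    simp only [List.cons.injEq, and_true] at h h'
    subst h h'
    obtain ⟨i, hi⟩ := port_unique hT hz
    rw [(hi j hw).1, (hi j' hw').1]

lemma insertIdentities_eq_self {D : ZXDiagram P} (h : ∀ v ∈ D.nodes, D.isReplaced v = false) :
    D.insertIdentities = D := by
  have key (N : List (ZXKind P × List ℕ)) (hN : ∀ v ∈ N, D.isReplaced v = false)
      (E : ZXDiagram P) : N.foldl (insertStep D) E = ⟨E.wires, E.nodes ++ N⟩ := by
    induction N generalizing E with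
    | nil => simp
    | cons v N ih =>
      rw [List.foldl_cons, ih fun u hu => hN u (List.mem_cons_of_mem v hu), insertStep_eq,
        hN v (by simp)]
      simp
  rw [insertIdentities, key _ h]
  simp

lemma countP_assemble {p : ZXKind P × List ℕ → Bool} (hp : ∀ x, p x → x.1.isTerminal) :
    (assemble K T W Λ).nodes.countP p = ((List.range T).map (portNode K Λ.length)).countP p := by
  have hzero (N : List (ZXKind P × List ℕ)) (hN : ∀ x ∈ N, x.1.isTerminal = false) :
      N.countP p = 0 := by
    rw [List.countP_eq_zero]
    intro x hx h
    have := hp x h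
    rw [hN x hx] at this
    simp at this
  change (_ ++ _ ++ _ ++ _ : List (ZXKind P × List ℕ)).countP p = _
  rw [List.countP_append, List.countP_append, List.countP_append, hzero (List.map (coreNode _ _ _) _),
    hzero (List.map (wireNode _) _), hzero (List.flatMap _ _)]
  · rfl
  · intro x hx
    simp only [List.mem_flatMap] at hx
    obtain ⟨e, -, hx⟩ := hx
    revert hx
    cases (legAt Λ e).2.2 <;> simp [chainNodes] <;> intro h <;>
      rcases h with rfl | rfl | rfl | rfl | rfl | rfl <;> rfl
  · intro x hx
    simp only [List.mem_map] at hx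
    obtain ⟨e, -, rfl⟩ := hx
    rfl
  · intro x hx
    simp only [List.mem_map] at hx
    obtain ⟨e, -, rfl⟩ := hx
    rfl

/-- Terminals occur only on ports, and no spider holds two ports, so no spider is crowded. -/
theorem insertIdentities_assemble (hT : ∀ j < T, (kindAt K j).isTerminal) :
    (assemble K T W Λ).insertIdentities = assemble K T W Λ := by
  refine insertIdentities_eq_self fun v _ => ?_
  suffices h : ∀ w, (assemble K T W Λ).crowded w = false by simp [isReplaced, h]
  intro w
  rw [crowded, List.any_eq_false]
  rintro ⟨k, l⟩ hx h
  simp only [Bool.and_eq_true, decide_eq_true_eq] at h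
  obtain ⟨⟨hz, -⟩, h2⟩ := h
  obtain ⟨α, rfl⟩ := ZXKind.isZ_iff.1 hz
  obtain ⟨i, hi⟩ := port_unique hT hx
  rw [terminalCount, ← List.countP_eq_length_filter,
    countP_assemble (fun x hx => (Bool.and_eq_true_iff.1 hx).1), List.countP_map] at h2
  have h1 : (List.range T).countP (fun j => j == i) ≤ 1 :=
    List.nodup_iff_count_le_one.1 List.nodup_range i
  refine absurd (h2.trans ((List.countP_mono_left fun j _ hj => ?_).trans h1)) (by norm_num)
  have hj' : 6 * Λ.length + j ∈ l := by simpa [portNode] using (Bool.and_eq_true_iff.1 hj).2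
  simpa using (hi j hj').1

omit [Zero P] in
lemma kindAt_eq_getElem {i : ℕ} (h : i < K.length) : kindAt K i = K[i] := by
  rw [kindAt, List.getD_eq_getElem _ _ h]

theorem isDiagram_assemble {n m : ℕ} (hT : ∀ j < T, (kindAt K j).isTerminal) (hTK : T ≤ K.length)
    (ho : ∀ e < Λ.length, (legAt Λ e).1 < K.length) (hW : ∀ e < Λ.length, (legAt Λ e).2.1 < W)
    (hi : ∀ i, .inp i ∈ K → i < n) (hi' : ∀ i < n, (K.take T).countP (ZXKind.isInp i) = 1)
    (hj : ∀ j, .out j ∈ K → j < m) (hj' : ∀ j < m, (K.take T).countP (ZXKind.isOut j) = 1) :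
    (assemble K T W Λ).IsDiagram n m := by
  have c := certificate_assemble hT hTK ho hW
  have hmem (k : ZXKind P) (hk : k.isTerminal) (l : List ℕ)
      (h : (k, l) ∈ (assemble K T W Λ).nodes) : k ∈ K := by
    obtain ⟨j, hj, rfl, -⟩ := terminal_mem_assemble hk h
    rw [kindAt_eq_getElem (by omega)]
    exact List.getElem_mem _
  have htake : K.take T = (List.range T).map (kindAt K) := by
    refine List.ext_getElem (by simp [hTK]) fun i h1 h2 => ?_
    simp only [List.length_map, List.length_range] at h2
    simp [kindAt_eq_getElem (K := K) (show i < K.length by omega)]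
  have hcount (p : ZXKind P → Bool) (hp : ∀ k, p k → k.isTerminal) :
      (assemble K T W Λ).nodes.countP (fun x => p x.1) = (K.take T).countP p := by
    rw [countP_assemble (fun x hx => hp _ hx), htake, List.countP_map, List.countP_map]
    rfl
  refine (isDiagram_iff n m _).2 ⟨c.legs_lt, fun w hw => .inl ?_, c.had_deg, c.terminal_deg,
    fun x hx i h => ?_, fun i h => ?_, fun x hx j h => ?_, fun j h => ?_⟩
  · rw [count_flatMap_legs, c.z_ends w hw, c.other_ends w hw]
  · exact hi i (h ▸ hmem x.1 (by rw [h]; rfl) x.2 hx)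
  · rw [hcount _ fun k hk => by rw [ZXKind.isInp_iff.1 hk]; rfl, hi' i h]
  · exact hj j (h ▸ hmem x.1 (by rw [h]; rfl) x.2 hx)
  · rw [hcount _ fun k hk => by rw [ZXKind.isOut_iff.1 hk]; rfl, hj' j h]

end Assemble

end ZXDiagram

/-! ### The interpretation of assembled diagrams -/

namespace ZXDiagram

open DBit

/-! ### Rearranging finite sums and products -/

section Sums

lemma prod_range_sum (n : ℕ) (f : ℕ → DBit → ℂ) :
    ∏ i ∈ Finset.range n, ∑ q, f i q =
      ∑ s : Fin n → DBit, ∏ i ∈ Finset.range n, f i (extend s i) := by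
  rw [Finset.prod_range, Fintype.prod_sum]
  refine Finset.sum_congr rfl fun s _ => ?_
  rw [Finset.prod_range]
  simp [extend]

/-- Each leg `e` has exactly one owner `o e`, so the product over spiders of their incident legs is
a product over legs. -/
lemma prod_prod_ite_eq (n k : ℕ) (o : ℕ → ℕ) (g : ℕ → ℕ → ℂ) (ho : ∀ e < n, o e < k) :
    ∏ i ∈ Finset.range k, ∏ e ∈ Finset.range n, (if o e = i then g e i else 1) =
      ∏ e ∈ Finset.range n, g e (o e) := by
  rw [Finset.prod_comm]
  refine Finset.prod_congr rfl fun e he => ?_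
  rw [Finset.prod_ite_eq, if_pos (Finset.mem_range.2 (ho e (Finset.mem_range.1 he)))]

lemma prod_filter_range (n : ℕ) (q : ℕ → Prop) [DecidablePred q] (f : ℕ → ℂ) :
    (((List.range n).filter fun e => q e).map f).prod =
      ∏ e ∈ Finset.range n, if q e then f e else 1 := by
  induction n with
  | zero => simp
  | succ n ih =>
    rw [List.range_succ, List.filter_append, List.map_append, List.prod_append, ih,
      Finset.prod_range_succ]
    by_cases h : q n <;> simp [h]

lemma prod_range_ite_lt {T n : ℕ} (h : T ≤ n) (f : ℕ → ℂ) :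
    ∏ i ∈ Finset.range n, (if i < T then f i else 1) = ∏ i ∈ Finset.range T, f i := by
  rw [← Finset.prod_subset (Finset.range_subset_range.2 h)]
  · exact Finset.prod_congr rfl fun i hi => if_pos (Finset.mem_range.1 hi)
  · exact fun i _ hi => if_neg fun h => hi (Finset.mem_range.2 h)

/-- Different rows share no wires, so the sum over all the wires factors into one sum for each block
of six. -/
lemma sum_blocks (L : ℕ) (g : ℕ → (Fin 6 → DBit) → ℂ) :
    ∑ s : Fin (6 * L) → DBit, ∏ e ∈ Finset.range L, g e (fun j => extend s (6 * e + j)) =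
      ∏ e ∈ Finset.range L, ∑ u, g e u := by
  induction L with
  | zero => exact sum_fin_zero _
  | succ L ih =>
    rw [Finset.prod_range_succ, ← ih, Finset.sum_mul]
    refine (sum_fin_add (6 * L) 6 (fun σ => ∏ e ∈ Finset.range (L + 1),
      g e (fun j => σ (6 * e + j)))).trans ?_
    refine Finset.sum_congr rfl fun s _ => ?_
    rw [Finset.mul_sum]
    refine Finset.sum_congr rfl fun t _ => ?_
    rw [Finset.prod_range_succ]
    congr 1
    · refine Finset.prod_congr rfl fun e he => congrArg (g e) (funext fun j => if_pos ?_)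
      have := Finset.mem_range.1 he
      have := j.2
      omega
    · congr 1
      funext j
      simp [extend]

lemma sum_blocks_mul (L T : ℕ) (g : ℕ → (Fin 6 → DBit) → ℂ) (h : ℕ → DBit → ℂ) :
    ∑ s : Fin (6 * L + T) → DBit, (∏ e ∈ Finset.range L, g e (fun j => extend s (6 * e + j))) *
        ∏ j ∈ Finset.range T, h j (extend s (6 * L + j)) =
      (∏ e ∈ Finset.range L, ∑ u, g e u) * ∏ j ∈ Finset.range T, ∑ q, h j q := by
  rw [sum_fin_add (6 * L) T (fun σ => (∏ e ∈ Finset.range L, g e (fun j => σ (6 * e + j))) *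
        ∏ j ∈ Finset.range T, h j (σ (6 * L + j))), ← sum_blocks, prod_range_sum, Finset.sum_mul_sum]
  refine Finset.sum_congr rfl fun s _ => Finset.sum_congr rfl fun t _ => ?_
  congr 1
  · refine Finset.prod_congr rfl fun e he => congrArg (g e) (funext fun j => if_pos ?_)
    have := Finset.mem_range.1 he
    have := j.2
    omega
  · simp

end Sums

/-- The identity tensor or the tensor of a Hadamard box. -/
noncomputable def legTensor (b : Bool) (p q : DBit) : ℂ := bif b then DBit.had p q else delta p q

/-- The scalar by which a row of Hadamard edges differs from `legTensor`. -/
def legScalar (b : Bool) : ℝ := bif b then 1 else 2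

/-! ### Summing out the rows and the ports -/

section Kernel

variable {n m : ℕ} (x x' : Fin n → Fin 2) (y y' : Fin m → Fin 2)

lemma tensorProd_map_range (k : ℕ) (f : ℕ → ZXKind Real.Angle × List ℕ) (σ : ℕ → DBit) :
    tensorProd x x' y y' ((List.range k).map f) σ =
      ∏ i ∈ Finset.range k, nodeTensor x x' y y' (f i).1 ((f i).2.map σ) := by
  induction k with
  | zero => simp [tensorProd]
  | succ k ih =>
    rw [List.range_succ, List.map_append, tensorProd_append, ih, Finset.prod_range_succ]
    simp [tensorProd]

lemma tensorProd_flatMap_range (k : ℕ) (f : ℕ → List (ZXKind Real.Angle × List ℕ))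
    (σ : ℕ → DBit) : tensorProd x x' y y' ((List.range k).flatMap f) σ =
      ∏ i ∈ Finset.range k, tensorProd x x' y y' (f i) σ := by
  induction k with
  | zero => simp [tensorProd]
  | succ k ih =>
    rw [List.range_succ, List.flatMap_append, tensorProd_append, ih, Finset.prod_range_succ]
    simp

/-- The tensor of the nodes of a leg. -/
noncomputable def chainTensor (b : Bool) (u : Fin 6 → DBit) : ℂ :=
  bif b then DBit.had (u 0) (u 1) * (delta (u 1) (u 2) * (DBit.had (u 2) (u 3) *
    (delta (u 3) (u 4) * DBit.had (u 4) (u 5))))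
  else DBit.had (u 0) (u 1) * (DBit.had (u 2) (u 3) * (delta (u 1) (u 4) * DBit.had (u 4) (u 5)))

lemma tensorProd_chainNodes (e : ℕ) (b : Bool) (σ : ℕ → DBit) :
    tensorProd x x' y y' (chainNodes e b) σ = chainTensor b fun j => σ (6 * e + j) := by
  cases b <;> simp [chainNodes, tensorProd, chainTensor, nodeTensor_Z_pair, nodeTensor_Z_single,
    nodeTensor_had, -mul_eq_mul_left_iff] <;> ring

/-- Consecutive Hadamard tensors cancel. A row of three leaves one gate; a row of two leaves the
identity, times the value 2 of the isolated edge. -/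
lemma sum_chainTensor (b : Bool) (p q : DBit) :
    ∑ u : Fin 6 → DBit, delta p (u 0) * chainTensor b u * delta q (u 5) =
      legScalar b * legTensor b p q := by
  have h1 : (1 : Fin 6) = Fin.succ 0 := rfl
  have h2 : (2 : Fin 6) = Fin.succ (Fin.succ 0) := rfl
  have h3 : (3 : Fin 6) = Fin.succ (Fin.succ (Fin.succ 0)) := rfl
  have h4 : (4 : Fin 6) = Fin.succ (Fin.succ (Fin.succ (Fin.succ 0))) := rfl
  have h5 : (5 : Fin 6) = Fin.succ (Fin.succ (Fin.succ (Fin.succ (Fin.succ 0)))) := rfl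
  cases b
  · have h (u : Fin 6 → DBit) : delta p (u 0) * chainTensor false u * delta q (u 5) =
        delta p (u 0) * (DBit.had (u 0) (u 1) * (DBit.had (u 2) (u 3) *
          (delta (u 1) (u 4) * (DBit.had (u 4) (u 5) * delta (u 5) q)))) := by
      simp only [chainTensor, cond_false, delta_comm q]
      ring
    simp only [h, sum_fin_succ, sum_fin_zero]
    simp only [h1, h2, h3, h4, h5, Fin.cons_zero, Fin.cons_succ, ← Finset.mul_sum, sum_delta_mul,
      sum_mul_delta, ← Finset.sum_mul, sum_sum_had]
    -- The isolated edge has become the factor 2; once it is moved outwards, the remaining two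
    -- Hadamard tensors are adjacent and cancel.
    simp only [mul_left_comm _ (2 : ℂ), ← Finset.mul_sum, sum_had_mul_had]
    simp [legScalar, legTensor]
  · have h (u : Fin 6 → DBit) : delta p (u 0) * chainTensor true u * delta q (u 5) =
        delta p (u 0) * (DBit.had (u 0) (u 1) * (delta (u 1) (u 2) * (DBit.had (u 2) (u 3) *
          (delta (u 3) (u 4) * (DBit.had (u 4) (u 5) * delta (u 5) q))))) := by
      simp only [chainTensor, cond_true, delta_comm q]
      ring
    simp only [h, sum_fin_succ, sum_fin_zero]
    simp only [h1, h2, h3, h4, h5, Fin.cons_zero, Fin.cons_succ, ← Finset.mul_sum, sum_delta_mul,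
      sum_mul_delta, sum_had_mul_had]
    simp [legScalar, legTensor]

/-- The weight of a node of kind `k` in the kernel. -/
noncomputable def coreWeight (k : ZXKind Real.Angle) (p : DBit) : ℂ :=
  weight k.corePhase p * if k.isTerminal then nodeTensor x x' y y' k [p] else 1

lemma tensorProd_coreNodes {K : List (ZXKind Real.Angle)} {T : ℕ} {Λ : List Leg}
    (hTK : T ≤ K.length) (ho : ∀ e < Λ.length, (legAt Λ e).1 < K.length) (σ : ℕ → DBit) :
    tensorProd x x' y y' ((List.range K.length).map (coreNode K T Λ)) σ =
      ∑ p : Fin K.length → DBit,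
        (∏ i ∈ Finset.range K.length, weight (kindAt K i).corePhase (extend p i)) *
        (∏ j ∈ Finset.range T, delta (extend p j) (σ (6 * Λ.length + j))) *
        ∏ e ∈ Finset.range Λ.length, delta (extend p (legAt Λ e).1) (σ (6 * e)) := by
  rw [tensorProd_map_range]
  simp only [coreNode, nodeTensor_Z, List.map_append, List.prod_append, List.map_map,
    prod_filter_range]
  rw [prod_range_sum]
  refine Finset.sum_congr rfl fun p _ => ?_
  rw [Finset.prod_mul_distrib, Finset.prod_mul_distrib, mul_assoc]
  congr 2
  · rw [← prod_range_ite_lt hTK]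
    refine Finset.prod_congr rfl fun i _ => ?_
    split_ifs <;> simp
  · exact prod_prod_ite_eq _ _ (fun e => (legAt Λ e).1)
      (fun e i => delta (extend p i) (σ (6 * e))) ho

lemma tensorProd_wireNodes {W : ℕ} {Λ : List Leg}
    (hW : ∀ e < Λ.length, (legAt Λ e).2.1 < W) (σ : ℕ → DBit) :
    tensorProd x x' y y' ((List.range W).map (wireNode Λ)) σ =
      ∑ s : Fin W → DBit,
        ∏ e ∈ Finset.range Λ.length, delta (extend s (legAt Λ e).2.1) (σ (6 * e + 5)) := by
  rw [tensorProd_map_range]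
  simp only [wireNode, nodeTensor_Z, List.map_map, prod_filter_range, weight_zero, one_mul]
  rw [prod_range_sum]
  refine Finset.sum_congr rfl fun s _ => ?_
  exact prod_prod_ite_eq _ _ (fun e => (legAt Λ e).2.1)
    (fun e i => delta (extend s i) (σ (6 * e + 5))) hW

/-- With the values `p` of the cores and `s` of the wire-spiders fixed, the wires of the assembled
diagram form independent rows and ports, and summing them out leaves one `legTensor` for each leg.
The values `s` then play the part of the original wire values. -/
theorem kernel_assemble {K : List (ZXKind Real.Angle)} {T W : ℕ} {Λ : List Leg}
    (hTK : T ≤ K.length) (hT : ∀ i < K.length, (kindAt K i).isTerminal ↔ i < T)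
    (ho : ∀ e < Λ.length, (legAt Λ e).1 < K.length) (hW : ∀ e < Λ.length, (legAt Λ e).2.1 < W) :
    (assemble K T W Λ).kernel x x' y y' =
      (∏ e ∈ Finset.range Λ.length, (legScalar (legAt Λ e).2.2 : ℂ)) *
      ∑ s : Fin W → DBit, ∑ p : Fin K.length → DBit,
        (∏ i ∈ Finset.range K.length, coreWeight x x' y y' (kindAt K i) (extend p i)) *
        ∏ e ∈ Finset.range Λ.length, legTensor (legAt Λ e).2.2 (extend p (legAt Λ e).1)
          (extend s (legAt Λ e).2.1) := by
  have hsum (s : Fin W → DBit) (p : Fin K.length → DBit) :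
      ∑ σ : Fin (6 * Λ.length + T) → DBit,
        (∏ e ∈ Finset.range Λ.length, delta (extend p (legAt Λ e).1) (extend σ (6 * e)) *
          chainTensor (legAt Λ e).2.2 (fun j => extend σ (6 * e + j)) *
          delta (extend s (legAt Λ e).2.1) (extend σ (6 * e + 5))) *
        ∏ j ∈ Finset.range T, delta (extend p j) (extend σ (6 * Λ.length + j)) *
          nodeTensor x x' y y' (kindAt K j) [extend σ (6 * Λ.length + j)] =
      (∏ e ∈ Finset.range Λ.length, (legScalar (legAt Λ e).2.2 : ℂ)) *
        (∏ e ∈ Finset.range Λ.length, legTensor (legAt Λ e).2.2 (extend p (legAt Λ e).1)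
          (extend s (legAt Λ e).2.1)) *
        ∏ j ∈ Finset.range T, nodeTensor x x' y y' (kindAt K j) [extend p j] := by
    refine (sum_blocks_mul Λ.length T (fun e u => delta (extend p (legAt Λ e).1) (u 0) *
      chainTensor (legAt Λ e).2.2 u * delta (extend s (legAt Λ e).2.1) (u 5))
      (fun j q => delta (extend p j) q * nodeTensor x x' y y' (kindAt K j) [q])).trans ?_
    simp only [sum_chainTensor, sum_delta_mul, Finset.prod_mul_distrib]
  have hcore (p : Fin K.length → DBit) :
      ∏ i ∈ Finset.range K.length, coreWeight x x' y y' (kindAt K i) (extend p i) =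
      (∏ i ∈ Finset.range K.length, weight (kindAt K i).corePhase (extend p i)) *
        ∏ j ∈ Finset.range T, nodeTensor x x' y y' (kindAt K j) [extend p j] := by
    rw [← prod_range_ite_lt hTK, ← Finset.prod_mul_distrib]
    refine Finset.prod_congr rfl fun i hi => ?_
    simp only [coreWeight, hT i (Finset.mem_range.1 hi)]
  have hnodes (σ : ℕ → DBit) : tensorProd x x' y y' (assemble K T W Λ).nodes σ =
      ∑ s : Fin W → DBit, ∑ p : Fin K.length → DBit,
        (∏ i ∈ Finset.range K.length, weight (kindAt K i).corePhase (extend p i)) *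
        ((∏ e ∈ Finset.range Λ.length, delta (extend p (legAt Λ e).1) (σ (6 * e)) *
          chainTensor (legAt Λ e).2.2 (fun j => σ (6 * e + j)) *
          delta (extend s (legAt Λ e).2.1) (σ (6 * e + 5))) *
        ∏ j ∈ Finset.range T, delta (extend p j) (σ (6 * Λ.length + j)) *
          nodeTensor x x' y y' (kindAt K j) [σ (6 * Λ.length + j)]) := by
    change tensorProd x x' y y' (_ ++ _ ++ _ ++ _) σ = _
    rw [tensorProd_append, tensorProd_append, tensorProd_append, tensorProd_coreNodes _ _ _ _ hTK ho,
      tensorProd_wireNodes _ _ _ _ hW, tensorProd_flatMap_range, tensorProd_map_range]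
    simp only [tensorProd_chainNodes, portNode, List.map_cons, List.map_nil,
      Finset.prod_mul_distrib, Finset.mul_sum, Finset.sum_mul]
    refine Finset.sum_congr rfl fun s _ => Finset.sum_congr rfl fun p _ => ?_
    ring
  rw [kernel_eq]
  simp only [hnodes]
  -- The sum over the new wires is moved inside, past the spider values, so that `hsum` applies for
  -- each choice of `s` and `p`.
  rw [Finset.sum_comm, Finset.mul_sum]
  refine Finset.sum_congr rfl fun s _ => ?_
  rw [Finset.sum_comm, Finset.mul_sum]
  refine Finset.sum_congr rfl fun p _ => ?_
  rw [← Finset.mul_sum, hcore]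
  exact (congrArg _ (hsum s p)).trans (by ring)

/-- The legs of a node: the wires, and whether there is a Hadamard gate between the wire and the
Z-spider which stands for the node. -/
def nodeLegs {P : Type} (v : ZXKind P × List ℕ) : List (ℕ × Bool) :=
  (v.2.take 1).map (fun w => (w, v.1.isX)) ++ (v.2.drop 1).map fun w => (w, !v.1.isZ)

/-- This factorisation makes all kinds of node alike. The first leg is singled out in `nodeLegs` for
the sake of the Hadamard box, which needs an identity on its first leg and a gate on its second;
both colours of spider treat all legs equally. -/
lemma nodeTensor_eq_sum {v : ZXKind Real.Angle × List ℕ} (hh : v.1 = .had → v.2.length = 2)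
    (ht : v.1.isTerminal → v.2.length = 1) (σ : ℕ → DBit) :
    nodeTensor x x' y y' v.1 (v.2.map σ) = ∑ p, coreWeight x x' y y' v.1 p *
      ((nodeLegs v).map fun t => legTensor t.2 p (σ t.1)).prod := by
  have hterm (k : ZXKind Real.Angle) (l : List ℕ) (hk : k.isTerminal) (hl : l.length = 1)
      (hX : k.isX = false) (h0 : k.corePhase = 0) :
      nodeTensor x x' y y' k (l.map σ) = ∑ p, coreWeight x x' y y' k p *
        ((nodeLegs (k, l)).map fun t => legTensor t.2 p (σ t.1)).prod := by
    obtain ⟨w, rfl⟩ := List.length_eq_one_iff.1 hl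
    simp [coreWeight, nodeLegs, hk, hX, h0, weight_zero, legTensor, sum_mul_delta]
  have hlegs (l : List ℕ) (b : Bool) (p : DBit) :
      (((l.take 1).map (fun w => (w, b)) ++ (l.drop 1).map fun w => (w, b)).map
        fun t => legTensor t.2 p (σ t.1)).prod = ((l.map σ).map (legTensor b p)).prod := by
    rw [← List.map_append, List.take_append_drop, List.map_map, List.map_map]
    rfl
  obtain ⟨k, l⟩ := v
  cases k with
  | Z α =>
    simp only [nodeTensor_Z, nodeLegs, ZXKind.isX, ZXKind.isZ, Bool.not_true, hlegs, coreWeight,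
      ZXKind.corePhase]
    simp [ZXKind.isTerminal, ZXKind.isBoundary, ZXKind.isGround]
    rfl
  | X α =>
    simp only [nodeTensor_X, nodeLegs, ZXKind.isX, ZXKind.isZ, Bool.not_false, hlegs, coreWeight,
      ZXKind.corePhase]
    simp [ZXKind.isTerminal, ZXKind.isBoundary, ZXKind.isGround]
    rfl
  | had =>
    obtain ⟨a, b, rfl⟩ := List.length_eq_two.1 (hh rfl)
    simp only [List.map_cons, List.map_nil, nodeTensor_had, coreWeight, ZXKind.corePhase,
      weight_zero, nodeLegs, ZXKind.isX, ZXKind.isZ]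
    simp [ZXKind.isTerminal, ZXKind.isBoundary, ZXKind.isGround, legTensor, delta_comm _ (σ a),
      sum_delta_mul]
  | _ => exact hterm _ l rfl (ht rfl) rfl rfl

end Kernel

end ZXDiagram

/-! ### The transformation of arbitrary diagrams -/

namespace ZXDiagram

section Expand

variable {P Q : Type}

/-- The nodes, with the inputs, outputs and grounds first. -/
def sortedNodes (D : ZXDiagram P) : List (ZXKind P × List ℕ) :=
  D.nodes.filter (fun v => v.1.isTerminal) ++ D.nodes.filter fun v => !v.1.isTerminal

def nodeAt (N : List (ZXKind P × List ℕ)) (i : ℕ) : ZXKind P × List ℕ := N.getD i (.gnd, [])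

def legTable (N : List (ZXKind P × List ℕ)) : List Leg :=
  (List.range N.length).flatMap fun i => (nodeLegs (nodeAt N i)).map fun t => (i, t)

/-- Replace each node and each wire by a Z-spider, and each leg by a row of Hadamard edges. -/
def expand [Zero P] (D : ZXDiagram P) : ZXDiagram P :=
  assemble (D.sortedNodes.map Prod.fst) (D.nodes.filter fun v => v.1.isTerminal).length D.wires
    (legTable D.sortedNodes)

lemma sortedNodes_perm (D : ZXDiagram P) : D.sortedNodes.Perm D.nodes :=
  List.filter_append_perm _ _

lemma nodeAt_mem {N : List (ZXKind P × List ℕ)} {i : ℕ} (h : i < N.length) : nodeAt N i ∈ N := by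
  rw [nodeAt, List.getD_eq_getElem _ _ h]
  exact List.getElem_mem h

lemma kindAt_map_fst (N : List (ZXKind P × List ℕ)) (i : ℕ) :
    kindAt (N.map Prod.fst) i = (nodeAt N i).1 :=
  List.getD_map N (.gnd, []) Prod.fst

lemma legAt_mem {Λ : List Leg} {e : ℕ} (h : e < Λ.length) : legAt Λ e ∈ Λ := by
  rw [legAt, List.getD_eq_getElem _ _ h]
  exact List.getElem_mem h

lemma mem_of_mem_nodeLegs {v : ZXKind P × List ℕ} {t : ℕ × Bool} (h : t ∈ nodeLegs v) :
    t.1 ∈ v.2 := by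
  simp only [nodeLegs, List.mem_append, List.mem_map] at h
  rcases h with ⟨w, hw, rfl⟩ | ⟨w, hw, rfl⟩
  · exact List.mem_of_mem_take hw
  · exact List.mem_of_mem_drop hw

lemma mem_legTable {N : List (ZXKind P × List ℕ)} {x : Leg} (h : x ∈ legTable N) :
    x.1 < N.length ∧ ∃ v ∈ N, x.2.1 ∈ v.2 := by
  simp only [legTable, List.mem_flatMap, List.mem_range, List.mem_map] at h
  obtain ⟨i, hi, t, ht, rfl⟩ := h
  exact ⟨hi, _, nodeAt_mem hi, mem_of_mem_nodeLegs ht⟩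

lemma nodeAt_isTerminal_iff (D : ZXDiagram P) {i : ℕ} (h : i < D.sortedNodes.length) :
    (nodeAt D.sortedNodes i).1.isTerminal ↔
      i < (D.nodes.filter fun v => v.1.isTerminal).length := by
  rw [nodeAt, List.getD_eq_getElem _ _ h]
  simp only [sortedNodes]
  constructor
  · intro ht
    by_contra hi
    rw [List.getElem_append_right (by omega)] at ht
    have hlt : i - (D.nodes.filter fun v => v.1.isTerminal).length <
        (D.nodes.filter fun v => !v.1.isTerminal).length := by
      simp only [sortedNodes, List.length_append] at h
      omega
    have := (List.mem_filter.1 (List.getElem_mem hlt)).2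
    simp [ht] at this
  · intro hi
    rw [List.getElem_append_left hi]
    exact (List.mem_filter.1 (List.getElem_mem hi)).2

lemma length_terminals_le (D : ZXDiagram P) :
    (D.nodes.filter fun v => v.1.isTerminal).length ≤ (D.sortedNodes.map Prod.fst).length := by
  simp [sortedNodes]

lemma kindAt_isTerminal_iff (D : ZXDiagram P) {i : ℕ}
    (h : i < (D.sortedNodes.map Prod.fst).length) :
    (kindAt (D.sortedNodes.map Prod.fst) i).isTerminal ↔
      i < (D.nodes.filter fun v => v.1.isTerminal).length := by
  rw [kindAt_map_fst]
  exact D.nodeAt_isTerminal_iff (by simpa using h)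

lemma legTable_owner_lt (D : ZXDiagram P) {e : ℕ} (h : e < (legTable D.sortedNodes).length) :
    (legAt (legTable D.sortedNodes) e).1 < (D.sortedNodes.map Prod.fst).length := by
  simpa using (mem_legTable (legAt_mem h)).1

lemma legTable_wire_lt {n m : ℕ} {D : ZXDiagram P} (hD : D.IsDiagram n m) {e : ℕ}
    (h : e < (legTable D.sortedNodes).length) :
    (legAt (legTable D.sortedNodes) e).2.1 < D.wires := by
  obtain ⟨v, hv, hw⟩ := (mem_legTable (legAt_mem h)).2
  exact ((isDiagram_iff n m D).1 hD).1 v (D.sortedNodes_perm.mem_iff.1 hv) _ hw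

variable [Zero P]

theorem insertIdentities_expand (D : ZXDiagram P) : D.expand.insertIdentities = D.expand :=
  insertIdentities_assemble fun _ hj =>
    (D.kindAt_isTerminal_iff (hj.trans_le D.length_terminals_le)).2 hj

variable {n m : ℕ} {D : ZXDiagram P}

theorem IsDiagram.strictlyGraphLike_expand (hD : D.IsDiagram n m) :
    D.expand.StrictlyGraphLike :=
  (certificate_assemble
    (fun _ hj => (D.kindAt_isTerminal_iff (hj.trans_le D.length_terminals_le)).2 hj)
    D.length_terminals_le (fun _ => D.legTable_owner_lt)
    (fun _ => legTable_wire_lt hD)).strictlyGraphLike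

theorem IsDiagram.isDiagram_expand (hD : D.IsDiagram n m) : D.expand.IsDiagram n m := by
  have hD' := (isDiagram_iff n m D).1 hD
  have hmem {k : ZXKind P} (h : k ∈ D.sortedNodes.map Prod.fst) : ∃ l, (k, l) ∈ D.nodes := by
    obtain ⟨v, hv, rfl⟩ := List.mem_map.1 h
    exact ⟨v.2, D.sortedNodes_perm.mem_iff.1 hv⟩
  have hcount (p : ZXKind P → Bool) (hp : ∀ k, p k → k.isTerminal) :
      ((D.sortedNodes.map Prod.fst).take
        (D.nodes.filter fun v => v.1.isTerminal).length).countP p =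
      D.nodes.countP fun x => p x.1 := by
    rw [← List.map_take, sortedNodes, List.take_left, List.countP_map, List.countP_filter]
    refine List.countP_congr fun v _ => ?_
    have := hp v.1
    simp only [Function.comp, Bool.and_eq_true]
    tauto
  refine isDiagram_assemble
    (fun _ hj => (D.kindAt_isTerminal_iff (hj.trans_le D.length_terminals_le)).2 hj)
    D.length_terminals_le (fun _ => D.legTable_owner_lt) (fun _ => legTable_wire_lt hD)
    (fun i h => ?_) (fun i h => ?_) (fun j h => ?_) (fun j h => ?_)
  · obtain ⟨l, h⟩ := hmem h
    exact hD'.2.2.2.2.1 _ h i rfl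
  · rw [hcount _ fun k hk => by rw [ZXKind.isInp_iff.1 hk]; rfl]
    exact hD'.2.2.2.2.2.1 i h
  · obtain ⟨l, h⟩ := hmem h
    exact hD'.2.2.2.2.2.2.1 _ h j rfl
  · rw [hcount _ fun k hk => by rw [ZXKind.isOut_iff.1 hk]; rfl]
    exact hD'.2.2.2.2.2.2.2 j h

end Expand

/-! ### Interpretation of the expanded diagram -/

section Semantics

variable {n m : ℕ} (x x' : Fin n → Fin 2) (y y' : Fin m → Fin 2)

lemma tensorProd_eq_prod_range (N : List (ZXKind Real.Angle × List ℕ)) (σ : ℕ → DBit) :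
    tensorProd x x' y y' N σ = ∏ i ∈ Finset.range (N.map Prod.fst).length,
      nodeTensor x x' y y' (nodeAt N i).1 ((nodeAt N i).2.map σ) := by
  rw [List.length_map, Finset.prod_range, tensorProd, ← Fin.prod_univ_fun_getElem]
  refine Finset.prod_congr rfl fun i _ => ?_
  rw [nodeAt, List.getD_eq_getElem _ _ i.2]

lemma prod_range_legAt (Λ : List Leg) (F : Leg → ℂ) :
    ∏ e ∈ Finset.range Λ.length, F (legAt Λ e) = (Λ.map F).prod := by
  rw [Finset.prod_range, ← Fin.prod_univ_fun_getElem]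
  refine Finset.prod_congr rfl fun e _ => ?_
  rw [legAt, List.getD_eq_getElem _ _ e.2]

lemma prod_map_legTable (N : List (ZXKind Real.Angle × List ℕ)) (F : Leg → ℂ) :
    ((legTable N).map F).prod = ∏ i ∈ Finset.range (N.map Prod.fst).length,
      ((nodeLegs (nodeAt N i)).map fun t => F (i, t)).prod := by
  have key (f : ℕ → List Leg) (k : ℕ) : (((List.range k).flatMap f).map F).prod =
      ∏ i ∈ Finset.range k, ((f i).map F).prod := by
    induction k with
    | zero => simp
    | succ k ih =>
      rw [List.range_succ, List.flatMap_append, List.map_append, List.prod_append, ih,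
        Finset.prod_range_succ]
      simp
  rw [legTable, key, List.length_map]
  refine Finset.prod_congr rfl fun i _ => ?_
  rw [List.map_map]
  rfl

theorem IsDiagram.equivalent_expand {D : ZXDiagram Real.Angle} (hD : D.IsDiagram n m) :
    Equivalent n m D D.expand := by
  have hD' := (isDiagram_iff n m D).1 hD
  set N := D.sortedNodes with hN
  -- This is 2 to the number of legs without a gate, hence positive whatever the diagram.
  set c : ℝ := ∏ e ∈ Finset.range (legTable N).length, legScalar (legAt (legTable N) e).2.2 with hc
  have hpos : 0 < c := Finset.prod_pos fun e _ => by
    cases (legAt (legTable N) e).2.2 <;> simp [legScalar]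
  refine equivalent_of_kernel c⁻¹ (inv_pos.2 hpos) fun x x' y y' => ?_
  have hkey : D.expand.kernel x x' y y' = c * D.kernel x x' y y' := by
    rw [expand, kernel_assemble x x' y y' D.length_terminals_le
      (fun _ => D.kindAt_isTerminal_iff) (fun _ => D.legTable_owner_lt)
      (fun _ => legTable_wire_lt hD), ← hN, hc, Complex.ofReal_prod]
    congr 1
    rw [kernel_eq]
    refine Finset.sum_congr rfl fun s _ => ?_
    have hperm : tensorProd x x' y y' D.nodes (extend s) = tensorProd x x' y y' N (extend s) :=
      (D.sortedNodes_perm.map _).prod_eq.symm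
    have hnode (i : ℕ) (hi : i ∈ Finset.range (N.map Prod.fst).length) :
        nodeTensor x x' y y' (nodeAt N i).1 ((nodeAt N i).2.map (extend s)) =
        ∑ p, coreWeight x x' y y' (nodeAt N i).1 p *
          ((nodeLegs (nodeAt N i)).map fun t => legTensor t.2 p (extend s t.1)).prod := by
      have hmem : nodeAt N i ∈ D.nodes :=
        D.sortedNodes_perm.mem_iff.1 (nodeAt_mem (by simpa using hi))
      exact nodeTensor_eq_sum x x' y y' (hD'.2.2.1 _ hmem) (hD'.2.2.2.1 _ hmem) _
    rw [hperm, tensorProd_eq_prod_range, Finset.prod_congr rfl hnode, prod_range_sum]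
    refine Finset.sum_congr rfl fun p _ => ?_
    rw [Finset.prod_mul_distrib]
    congr 1
    · simp only [kindAt_map_fst]
    · rw [prod_range_legAt (legTable N) fun t => legTensor t.2.2 (extend p t.1) (extend s t.2.1),
        prod_map_legTable]
  rw [hkey, Complex.ofReal_inv, inv_mul_cancel_left₀ (by exact_mod_cast hpos.ne')]

end Semantics

/-! ### Change of phases -/

section Map

variable {P Q : Type} (f : P → Q)

lemma map_isTerminal (k : ZXKind P) : (k.map f).isTerminal = k.isTerminal := by cases k <;> rfl

lemma map_isInp (k : ZXKind P) (i : ℕ) : (k.map f).isInp i = k.isInp i := by cases k <;> rfl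

lemma map_isOut (k : ZXKind P) (i : ℕ) : (k.map f).isOut i = k.isOut i := by cases k <;> rfl

theorem IsDiagram.map {n m : ℕ} {D : ZXDiagram P} (hD : D.IsDiagram n m) :
    (D.map f).IsDiagram n m := by
  obtain ⟨h1, h2, h3, h4, h5, h6, h7, h8⟩ := (isDiagram_iff n m D).1 hD
  refine (isDiagram_iff n m _).2 ⟨?_, ?_, ?_, ?_, ?_, ?_, ?_, ?_⟩
  · intro x hx
    obtain ⟨v, hv, rfl⟩ := List.mem_map.1 hx
    exact h1 v hv
  · have : (D.map f).nodes.flatMap Prod.snd = D.nodes.flatMap Prod.snd := List.flatMap_map ..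
    rw [this]
    exact h2
  · intro x hx hk
    obtain ⟨v, hv, rfl⟩ := List.mem_map.1 hx
    refine h3 v hv ?_
    cases hv1 : v.1 <;> simp [hv1, ZXKind.map] at hk ⊢
  · intro x hx hk
    obtain ⟨v, hv, rfl⟩ := List.mem_map.1 hx
    exact h4 v hv (by rwa [map_isTerminal] at hk)
  · intro x hx i hk
    obtain ⟨v, hv, rfl⟩ := List.mem_map.1 hx
    rw [← ZXKind.isInp_iff, map_isInp, ZXKind.isInp_iff] at hk
    exact h5 v hv i hk
  · intro i hi
    rw [← h6 i hi]
    change (List.map _ _).countP _ = _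
    rw [List.countP_map]
    exact List.countP_congr fun v _ => by simp only [Function.comp, map_isInp]
  · intro x hx i hk
    obtain ⟨v, hv, rfl⟩ := List.mem_map.1 hx
    rw [← ZXKind.isOut_iff, map_isOut, ZXKind.isOut_iff] at hk
    exact h7 v hv i hk
  · intro i hi
    rw [← h8 i hi]
    change (List.map _ _).countP _ = _
    rw [List.countP_map]
    exact List.countP_congr fun v _ => by simp only [Function.comp, map_isOut]

lemma kindAt_map (K : List (ZXKind P)) (i : ℕ) :
    kindAt (K.map (ZXKind.map f)) i = (kindAt K i).map f :=
  List.getD_map K .gnd (ZXKind.map f)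

lemma legTable_map (N : List (ZXKind P × List ℕ)) :
    legTable (N.map fun v => (v.1.map f, v.2)) = legTable N := by
  have hnode (i : ℕ) : nodeAt (N.map fun v => (v.1.map f, v.2)) i =
      ((nodeAt N i).1.map f, (nodeAt N i).2) :=
    List.getD_map N (.gnd, []) fun v : ZXKind P × List ℕ => (v.1.map f, v.2)
  have hlegs (v : ZXKind P × List ℕ) : nodeLegs (v.1.map f, v.2) = nodeLegs v := by
    obtain ⟨k, l⟩ := v
    cases k <;> rfl
  simp only [legTable, hnode, hlegs, List.length_map]

variable {f} [Zero P] [Zero Q]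

lemma map_assemble (hf : f 0 = 0) (K : List (ZXKind P)) (T W : ℕ) (Λ : List Leg) :
    (assemble K T W Λ).map f = assemble (K.map (ZXKind.map f)) T W Λ := by
  have hphase (k : ZXKind P) : f k.corePhase = (k.map f).corePhase := by
    cases k <;> first | rfl | exact hf
  simp only [assemble, ZXDiagram.map, List.map_append, List.map_map, List.map_flatMap,
    List.length_map]
  congr 1
  refine congrArg₂ _ (congrArg₂ _ (congrArg₂ _ ?_ ?_) ?_) (congrArg (List.flatMap · _) ?_)
  · exact List.map_congr_left fun j _ => by simp [portNode, kindAt_map]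
  · exact List.map_congr_left fun i _ => by simp [coreNode, kindAt_map, ZXKind.map, hphase]
  · exact List.map_congr_left fun w _ => by simp [wireNode, ZXKind.map, hf]
  · funext e
    cases (legAt Λ e).2.2 <;> simp [chainNodes, ZXKind.map, hf]

/-- Phases are only copied from spiders to their cores, and every other phase written is 0. So
evaluating before or after expanding gives the same diagram, which makes one symbolic algorithm
valid for all values of the indeterminates. -/
theorem map_expand (hf : f 0 = 0) (D : ZXDiagram P) : D.expand.map f = (D.map f).expand := by
  have hfilter (p : ZXKind P → Bool) (q : ZXKind Q → Bool) (hpq : ∀ k, q (k.map f) = p k) :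
      (D.map f).nodes.filter (fun v => q v.1) =
        (D.nodes.filter fun v => p v.1).map fun v => (v.1.map f, v.2) := by
    change (List.map _ _).filter _ = _
    rw [List.filter_map]
    simp only [Function.comp_def, hpq]
  have ht := hfilter ZXKind.isTerminal ZXKind.isTerminal (map_isTerminal f)
  have hs : (D.map f).sortedNodes = D.sortedNodes.map fun v => (v.1.map f, v.2) := by
    rw [sortedNodes, sortedNodes, List.map_append, ht,
      hfilter (fun k => !k.isTerminal) (fun k => !k.isTerminal) fun k => by rw [map_isTerminal]]
  rw [expand, expand, map_assemble hf, hs, ht, legTable_map, List.length_map, List.map_map,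
    List.map_map]
  rfl

end Map

/-! ### Computability -/

section Computability

variable {P : Type} [Primcodable P]

open Primrec

/-- The coding of kinds is transported along `equivSum`, so matching on a kind is a nested case
distinction on sums. -/
lemma _root_.ZXKind.primrec_cases {α β : Type} [Primcodable α] [Primcodable β]
    {k : α → ZXKind P} {fZ fX : α → P → β} {fh fg : α → β} {fi fo : α → ℕ → β} (hk : Primrec k)
    (hZ : Primrec₂ fZ) (hX : Primrec₂ fX) (hh : Primrec fh) (hg : Primrec fg) (hi : Primrec₂ fi)
    (ho : Primrec₂ fo) : Primrec fun a => (match k a with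
      | .Z φ => fZ a φ
      | .X φ => fX a φ
      | .had => fh a
      | .gnd => fg a
      | .inp i => fi a i
      | .out j => fo a j : β) := by
  have hb : Primrec₂ fun (a : α) (b : Bool) => bif b then fg a else fh a :=
    (Primrec.cond snd (hg.comp fst) (hh.comp fst)).to₂
  have hio : Primrec₂ fun (a : α) (s : ℕ ⊕ ℕ) => (Sum.casesOn s (fi a) (fo a) : β) :=
    (sumCasesOn snd (hi.comp (fst.comp fst) snd).to₂ (ho.comp (fst.comp fst) snd).to₂).to₂
  have hZX : Primrec₂ fun (a : α) (s : P ⊕ P) => (Sum.casesOn s (fZ a) (fX a) : β) :=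
    (sumCasesOn snd (hZ.comp (fst.comp fst) snd).to₂ (hX.comp (fst.comp fst) snd).to₂).to₂
  have hrest : Primrec₂ fun (a : α) (s : Bool ⊕ (ℕ ⊕ ℕ)) =>
      (Sum.casesOn s (fun b => bif b then fg a else fh a)
        (fun s => Sum.casesOn s (fi a) (fo a)) : β) :=
    (sumCasesOn snd (hb.comp (fst.comp fst) snd).to₂ (hio.comp (fst.comp fst) snd).to₂).to₂
  refine (sumCasesOn ((of_equiv (e := ZXKind.equivSum P)).comp hk) hZX hrest).of_eq fun a => ?_
  cases k a <;> rfl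

lemma _root_.ZXKind.primrec_Z : Primrec (ZXKind.Z : P → ZXKind P) :=
  (of_equiv_symm (e := ZXKind.equivSum P)).comp (sumInl.comp sumInl)

lemma _root_.ZXKind.primrec_isTerminal : Primrec (ZXKind.isTerminal : ZXKind P → Bool) :=
  (ZXKind.primrec_cases Primrec.id (Primrec.const false).to₂ (Primrec.const false).to₂
    (Primrec.const false) (Primrec.const true) (Primrec.const true).to₂
    (Primrec.const true).to₂).of_eq fun k => by cases k <;> rfl

lemma _root_.ZXKind.primrec_isX : Primrec (ZXKind.isX : ZXKind P → Bool) :=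
  (ZXKind.primrec_cases Primrec.id (Primrec.const false).to₂ (Primrec.const true).to₂
    (Primrec.const false) (Primrec.const false) (Primrec.const false).to₂
    (Primrec.const false).to₂).of_eq fun k => by cases k <;> rfl

lemma _root_.ZXKind.primrec_isZ : Primrec (ZXKind.isZ : ZXKind P → Bool) :=
  (ZXKind.primrec_cases Primrec.id (Primrec.const true).to₂ (Primrec.const false).to₂
    (Primrec.const false) (Primrec.const false) (Primrec.const false).to₂
    (Primrec.const false).to₂).of_eq fun k => by cases k <;> rfl

lemma _root_.ZXKind.primrec_corePhase [Zero P] : Primrec (ZXKind.corePhase : ZXKind P → P) :=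
  (ZXKind.primrec_cases Primrec.id Primrec₂.right Primrec₂.right
    (Primrec.const 0) (Primrec.const 0) (Primrec.const 0).to₂
    (Primrec.const 0).to₂).of_eq fun k => by cases k <;> rfl

lemma primrec_wires : Primrec (ZXDiagram.wires : ZXDiagram P → ℕ) :=
  fst.comp (of_equiv (e := equivProd P))

lemma primrec_nodes : Primrec (ZXDiagram.nodes : ZXDiagram P → List (ZXKind P × List ℕ)) :=
  snd.comp (of_equiv (e := equivProd P))

lemma primrec_mk : Primrec₂ (ZXDiagram.mk : ℕ → List (ZXKind P × List ℕ) → ZXDiagram P) :=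
  (of_equiv_symm (e := equivProd P)).to₂

lemma primrec_filter {α : Type} [Primcodable α] {p : α → Bool} (hp : Primrec p) :
    Primrec fun l : List α => l.filter p := by
  have : PrimrecPred fun a => p a = true := Primrec.eq.comp hp (Primrec.const true)
  refine (Primrec.listFilter this).of_eq fun l => ?_
  simp

lemma primrec_nodeLegs : Primrec (nodeLegs : ZXKind P × List ℕ → List (ℕ × Bool)) :=
  list_append.comp
    (list_map (list_take.comp (Primrec.const 1) snd)
      (Primrec.pair snd (ZXKind.primrec_isX.comp (fst.comp fst))).to₂)
    (list_map (list_drop.comp (Primrec.const 1) snd)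
      (Primrec.pair snd (Primrec.not.comp (ZXKind.primrec_isZ.comp (fst.comp fst)))).to₂)

lemma primrec_legTable : Primrec (legTable : List (ZXKind P × List ℕ) → List Leg) :=
  list_flatMap (list_range.comp list_length)
    (list_map (primrec_nodeLegs.comp ((list_getD _).comp fst snd))
      (Primrec.pair (snd.comp fst) snd).to₂).to₂

lemma primrec_sortedNodes :
    Primrec (sortedNodes : ZXDiagram P → List (ZXKind P × List ℕ)) :=
  list_append.comp
    ((primrec_filter (ZXKind.primrec_isTerminal.comp fst)).comp primrec_nodes)
    ((primrec_filter (Primrec.not.comp (ZXKind.primrec_isTerminal.comp fst))).comp primrec_nodes)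

variable [Zero P]

lemma primrec_six_mul_add (c : ℕ) : Primrec fun e : ℕ => 6 * e + c :=
  nat_add.comp (nat_mul.comp (Primrec.const 6) Primrec.id) (Primrec.const c)

lemma primrec_chainNodes :
    Primrec₂ (chainNodes : ℕ → Bool → List (ZXKind P × List ℕ)) := by
  have hw (c : ℕ) : Primrec fun a : ℕ × Bool => 6 * a.1 + c := (primrec_six_mul_add c).comp fst
  have hnil {α : Type} [Primcodable α] : Primrec fun _ : ℕ × Bool => ([] : List α) := Primrec.const []
  have h1 (k : ZXKind P) (c : ℕ) : Primrec fun a : ℕ × Bool => (k, [6 * a.1 + c]) :=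
    Primrec.pair (Primrec.const k) (list_cons.comp (hw c) hnil)
  have h2 (k : ZXKind P) (c d : ℕ) : Primrec fun a : ℕ × Bool => (k, [6 * a.1 + c, 6 * a.1 + d]) :=
    Primrec.pair (Primrec.const k) (list_cons.comp (hw c) (list_cons.comp (hw d) hnil))
  exact list_append.comp
    (list_cons.comp (h2 .had 0 1) (list_cons.comp (h2 .had 2 3)
      (list_cons.comp (h2 .had 4 5) hnil)))
    (Primrec.cond snd
      (list_cons.comp (h2 (.Z 0) 1 2) (list_cons.comp (h2 (.Z 0) 3 4) hnil))
      (list_cons.comp (h2 (.Z 0) 1 4) (list_cons.comp (h1 (.Z 0) 2)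
        (list_cons.comp (h1 (.Z 0) 3) hnil))))

/-- The data from which a diagram is assembled. -/
abbrev AssemblyData (P : Type) : Type := (List (ZXKind P) × ℕ) × ℕ × List Leg

omit [Zero P] in
lemma primrec_filter_legAt {g : Leg → ℕ} (hg : Primrec g) (c : ℕ) :
    Primrec₂ fun (d : AssemblyData P) (i : ℕ) =>
      ((List.range d.2.2.length).filter fun e => g (legAt d.2.2 e) = i).map
        fun e => 6 * e + c := by
  have hrel : PrimrecRel fun (e : ℕ) (a : AssemblyData P × ℕ) => g (legAt a.1.2.2 e) = a.2 :=
    Primrec.eq.comp (hg.comp ((list_getD _).comp (snd.comp (snd.comp (fst.comp snd))) fst))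
      (snd.comp snd)
  have hrange : Primrec fun a : AssemblyData P × ℕ => List.range a.1.2.2.length :=
    list_range.comp (list_length.comp (snd.comp (snd.comp fst)))
  exact list_map ((PrimrecRel.listFilter hrel).comp hrange Primrec.id)
    ((primrec_six_mul_add c).comp snd).to₂

lemma primrec_assemble :
    Primrec fun d : AssemblyData P => assemble d.1.1 d.1.2 d.2.1 d.2.2 := by
  have hL : Primrec fun d : AssemblyData P => d.2.2.length := list_length.comp (snd.comp snd)
  have h6 {c : AssemblyData P × ℕ → ℕ} (hc : Primrec c) :
      Primrec fun a : AssemblyData P × ℕ => 6 * a.1.2.2.length + c a :=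
    nat_add.comp (nat_mul.comp (Primrec.const 6) (hL.comp fst)) hc
  have hkind : Primrec fun a : AssemblyData P × ℕ => kindAt a.1.1.1 a.2 :=
    (list_getD _).comp (fst.comp (fst.comp fst)) snd
  have hsingle : Primrec fun a : AssemblyData P × ℕ => [6 * a.1.2.2.length + a.2] :=
    list_cons.comp (h6 snd) (Primrec.const [])
  have hport : Primrec₂ fun (d : AssemblyData P) (j : ℕ) => portNode d.1.1 d.2.2.length j :=
    Primrec.pair hkind hsingle
  have hcore : Primrec₂ fun (d : AssemblyData P) (i : ℕ) => coreNode d.1.1 d.1.2 d.2.2 i :=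
    Primrec.pair (ZXKind.primrec_Z.comp (ZXKind.primrec_corePhase.comp hkind))
      (list_append.comp
        (Primrec.ite (nat_lt.comp snd (snd.comp (fst.comp fst))) hsingle (Primrec.const []))
        (primrec_filter_legAt fst 0))
  have hwire : Primrec₂ fun (d : AssemblyData P) (w : ℕ) => wireNode (P := P) d.2.2 w :=
    Primrec.pair (Primrec.const _) (primrec_filter_legAt (fst.comp snd) 5)
  have hchain : Primrec₂ fun (d : AssemblyData P) (e : ℕ) =>
      chainNodes (P := P) e (legAt d.2.2 e).2.2 :=
    primrec_chainNodes.comp snd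
      (snd.comp (snd.comp ((list_getD _).comp (snd.comp (snd.comp fst)) snd)))
  exact primrec_mk.comp
    (nat_add.comp (nat_mul.comp (Primrec.const 6) hL) (snd.comp fst))
    (list_append.comp
      (list_append.comp
        (list_append.comp (list_map (list_range.comp (snd.comp fst)) hport)
          (list_map (list_range.comp (list_length.comp (fst.comp fst))) hcore))
        (list_map (list_range.comp (fst.comp snd)) hwire))
      (list_flatMap (list_range.comp hL) hchain))

theorem primrec_expand : Primrec (expand : ZXDiagram P → ZXDiagram P) :=
  primrec_assemble.comp (Primrec.pair
    (Primrec.pair (list_map primrec_sortedNodes (fst.comp snd).to₂)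
      (list_length.comp
        ((primrec_filter (ZXKind.primrec_isTerminal.comp fst)).comp primrec_nodes)))
    (Primrec.pair primrec_wires (primrec_legTable.comp primrec_sortedNodes)))

end Computability

end ZXDiagram

/-! ### Evaluation of symbolic phases and the main theorem -/

lemma PhaseExpr.eval_zero (θ : ℕ → Real.Angle) : PhaseExpr.eval θ 0 = 0 := by
  change (((0 : ℚ) : ℝ) * Real.pi : ℝ) + (List.map _ []).sum = (0 : Real.Angle)
  simp

theorem mainTheorem3 :
    -- every diagram is equivalent to a weakly graph-like one
    (∀ (n m : ℕ) (D : ZXDiagram Real.Angle), D.IsDiagram n m →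
      ∃ D' : ZXDiagram Real.Angle,
        D'.IsDiagram n m ∧ D'.WeaklyGraphLike ∧ ZXDiagram.Equivalent n m D D') ∧
    -- inserting identity spiders makes weakly graph-like diagrams strictly graph-like
    (∀ (n m : ℕ) (D : ZXDiagram Real.Angle), D.IsDiagram n m → D.WeaklyGraphLike →
      D.insertIdentities.IsDiagram n m ∧ D.insertIdentities.StrictlyGraphLike ∧
        ZXDiagram.Equivalent n m D D.insertIdentities) ∧
    -- there is an algorithm for the transformation of arbitrary diagrams, uniform in the phases
    (∃ W : ZXDiagram PhaseExpr → ZXDiagram PhaseExpr,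
      Computable W ∧
      Computable (fun D : ZXDiagram PhaseExpr => (W D).insertIdentities) ∧
      ∀ (n m : ℕ) (D : ZXDiagram PhaseExpr), D.IsDiagram n m →
        (W D).IsDiagram n m ∧ (W D).insertIdentities.IsDiagram n m ∧
        ∀ θ : ℕ → Real.Angle,
          ((W D).map (PhaseExpr.eval θ)).WeaklyGraphLike ∧
          ZXDiagram.Equivalent n m (D.map (PhaseExpr.eval θ)) ((W D).map (PhaseExpr.eval θ)) ∧
          ((W D).insertIdentities.map (PhaseExpr.eval θ)).StrictlyGraphLike ∧
          ZXDiagram.Equivalent n m (D.map (PhaseExpr.eval θ))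
            ((W D).insertIdentities.map (PhaseExpr.eval θ))) := by
  refine ⟨fun n m D hD => ?_, fun n m D hD hw => ?_, ZXDiagram.expand, ?_, ?_, fun n m D hD => ?_⟩
  · exact ⟨D.expand, hD.isDiagram_expand, hD.strictlyGraphLike_expand.weaklyGraphLike, hD.equivalent_expand⟩
  · exact ⟨hw.isDiagram_insertIdentities hD, (hw.certificate hD).strictlyGraphLike,
      hD.equivalent_insertIdentities⟩
  · exact ZXDiagram.primrec_expand.to_comp
  · simpa only [ZXDiagram.insertIdentities_expand] using ZXDiagram.primrec_expand.to_comp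
  -- Identity insertion is trivial on expanded diagrams and evaluation commutes with expansion, so
  -- every claim reduces to one about `expand` of the evaluated diagram.
  · simp only [ZXDiagram.insertIdentities_expand, ZXDiagram.map_expand (PhaseExpr.eval_zero _)]
    refine ⟨hD.isDiagram_expand, hD.isDiagram_expand, fun θ => ?_⟩
    have hθ := hD.map (PhaseExpr.eval θ)
    exact ⟨hθ.strictlyGraphLike_expand.weaklyGraphLike, hθ.equivalent_expand,
      hθ.strictlyGraphLike_expand, hθ.equivalent_expand⟩
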